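/- Conventions. All graphs are finite and simple. An embedding of a graph $H$ into a graph $G$ is an injective map $V(H)\to V(G)$ that sends edges to edges. A vertex of a graph is universal if it is adjacent to all other vertices. A graph is $m$-good if it has $m+1$ vertices, minimum degree at least $\lfloor \frac{2m}{3}\rfloor$ and a universal vertex. A leaf is a vertex of degree $1$. Let $T$ be a tree with $m$ edges and $\gamma>0$. A subtree $T^*$ of $T$ with root $t^*\in V(T^*)$ is a $\gamma$-nice subtree of $T$ if $|V(T^*)|\le\gamma m$, every component of $T-V(T^*)$ contains a neighbour of $t^*$, and at least one of the following holds: (1) $T^*$ contains at least $\lceil\frac{\gamma m}{20}\rceil$ pairwise vertex-disjoint paths with five vertices each, such that all vertices on these paths have degree at most $2$ in $T$; (2) $T^*$ contains at least $\lceil\frac{\gamma m}{40}\rceil$ leaves of $T$. Lemma. There is an $m_0\in\mathbb N$ such that the following holds for all $m\ge m_0$ and all real $\gamma$ with $\frac{2}{10^7}\le\gamma<\frac1{30}$. Let $G$ be an $m$-good graph, and let $w$ be a universal vertex of $G$. Let $T$ be a tree with $m$ edges such that no vertex of $T$ is adjacent to more than $\frac{m}{10^{23}}$ leaves of $T$.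 Let $T^*$ be a $\gamma$-nice subtree of $T$ with root $t^*$. Then there are sets $L\subseteq V(T^*)\setminus\{t^*\}$ and $S\subseteq V(G)$ with $$|S|\le|L|-\Big\lceil\Big(\frac{\gamma}{2}\Big)^4m\Big\rceil$$ such that for every $w'\in V(G)\setminus S$ with $w'\ne w$ there is an embedding $f$ of $T^*-L$ into $G-S$ with $f(t^*)=w'$ and with the following property: every embedding $g$ of $T-L$ into $G-S$ that extends $f$ can be extended to an embedding of $T$ into $G$. -/

import Mathlib

namespace SpanningTrees

/-- A leaf of a graph: a vertex of degree one. -/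
def IsLeaf {U : Type*} [Fintype U] (T : SimpleGraph U) [DecidableRel T.Adj] (v : U) : Prop :=
  T.degree v = 1

/-- `G` is `m`-good: it has `m + 1` vertices, minimum degree at least `⌊2m/3⌋`
(`/` is the floor division of natural numbers here), and a universal vertex. -/
def IsGood {V : Type*} [Fintype V] (m : ℕ) (G : SimpleGraph V) [DecidableRel G.Adj] : Prop :=
  Fintype.card V = m + 1 ∧ 2 * m / 3 ≤ G.minDegree ∧ G.universalVerts.Nonempty

/-- Type 1: the subtree contains at least `⌈γ m / 20⌉` pairwise vertex-disjoint paths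
`p i 0, p i 1, p i 2, p i 3, p i 4`, all of whose vertices have degree at most `2` in `T`.
Lengths of paths are counted in vertices. This is the weaker requirement of the two: a path
with five edges contains a path with five vertices. -/
def IsTypeOne {U : Type*} [Fintype U] (m : ℕ) (γ : ℝ) (T : SimpleGraph U) [DecidableRel T.Adj]
    (Tstar : T.Subgraph) : Prop :=
  ∃ p : Fin ⌈γ * m / 20⌉₊ → Fin 5 → U,
    Function.Injective (Function.uncurry p) ∧
    (∀ i, ∀ j : Fin 4, Tstar.Adj (p i j.castSucc) (p i j.succ)) ∧
    ∀ i j, T.degree (p i j) ≤ 2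

/-- Type 2: the subtree contains at least `⌈γ m / 40⌉` leaves of `T`. -/
def IsTypeTwo {U : Type*} [Fintype U] (m : ℕ) (γ : ℝ) (T : SimpleGraph U) [DecidableRel T.Adj]
    (Tstar : T.Subgraph) : Prop :=
  ⌈γ * m / 40⌉₊ ≤ {v ∈ Tstar.verts | IsLeaf T v}.ncard

/-- For a tree `T` with `m` edges: the subtree `Tstar` of `T`, rooted at its vertex `t`,
is a `γ`-nice subtree of `T`. -/
structure IsNiceSubtree {U : Type*} [Fintype U] (m : ℕ) (γ : ℝ) (T : SimpleGraph U)
    [DecidableRel T.Adj] (Tstar : T.Subgraph) (t : U) : Prop where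
  isTree : Tstar.coe.IsTree
  root_mem : t ∈ Tstar.verts
  card_le : (Tstar.verts.ncard : ℝ) ≤ γ * m
  component_adj : ∀ C : (T.induce Tstar.vertsᶜ).ConnectedComponent, ∃ x ∈ C.supp, T.Adj x t
  type_one_or_two : IsTypeOne m γ T Tstar ∨ IsTypeTwo m γ T Tstar

end SpanningTrees

/-! The set `S` is reserved together with `L`, and the embedding `f` is arranged so that `L` can be
matched into whatever `g` leaves free. The free set `R` contains `S` and has exactly `|L|` vertices.
The vertices of `L` are independent with all neighbours in `T* - L`, so only Hall's condition
between `L` and `R` is at stake, for every possible `R` (`exists_extension`).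

Type 1 (`exists_of_paths`): `L` consists of middle vertices of paths, indexed by `I`, and `S` of
vertices `s i` for all but `k` of these indices. The neighbours of a middle vertex go to `x i`, `y
i`, both adjacent to `s i` when it exists. So `S` matches most of `L` by itself, and the pairs are
spread so evenly that the `k` remaining slots can be filled by rerouting
(`card_le_card_common_nbr`).

Type 2 (`exists_of_leaves`): `L` consists of leaves, and the parent `j` with the most leaves, `b` of
them, goes to the universal vertex `w`. A set of leaves containing a child of `j` accepts all of
`R`; small sets are served by `S`; a large set missing the children of `j` has `b` vertices to
spare, and at most `b` vertices of `G` are atypical (`card_few_hits_le`).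

All random choices are derandomised: options are fixed one at a time so that an exponential
potential, summed over all events to be controlled, never grows. -/

namespace SpanningTrees

open Finset Real

/-! ### Exponential potentials and the method of conditional expectations. -/

section Potential

open scoped Classical

/-- From `e^(-u) ≤ 1 - u + u²` one gets `1 - e^(-u) ≥ u (1 - η)`; the factor `1 - η` is the price of
linearising. -/
theorem one_sub_mul_le_exp {u p η : ℝ} (hu : 0 ≤ u) (hu' : u ≤ η) (hη : η ≤ 1) (hp : 0 ≤ p) :
    1 - p * (1 - exp (-u)) ≤ exp (-(u * (p * (1 - η)))) := by
  have h1 : |(-u)| ≤ 1 := by rw [abs_neg, abs_of_nonneg hu]; linarith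
  have h2 := (abs_le.1 (abs_exp_sub_one_sub_id_le h1)).2
  have h3 : u * (1 - η) ≤ 1 - exp (-u) := by nlinarith
  have h4 := mul_le_mul_of_nonneg_left h3 hp
  have h5 := add_one_le_exp (-(u * (p * (1 - η))))
  nlinarith

/-- One uniformly chosen option multiplies the potential by at most `1` on average. Weight `u = 0`
needs no assumption on hits, so a step may be made irrelevant to an event. -/
theorem sum_exp_le_card {α : Type*} {u p η : ℝ} (hη : η ≤ 1) (hp : 0 ≤ p)
    (Ω : Finset α) (hit : α → Prop) (hu : 0 ≤ u) (hu' : u ≤ η)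
    (hcard : u ≠ 0 → p * #Ω ≤ #{ω ∈ Ω | hit ω}) :
    ∑ ω ∈ Ω, exp (u * (p * (1 - η) - if hit ω then 1 else 0)) ≤ #Ω := by
  rcases eq_or_ne u 0 with rfl | h0
  · simp
  have hc := hcard h0
  have hsplit : ∀ ω, exp (u * (p * (1 - η) - if hit ω then 1 else 0)) =
      exp (u * (p * (1 - η))) * (1 - (1 - exp (-u)) * if hit ω then 1 else 0) := by
    intro ω
    split_ifs
    · rw [mul_sub, sub_eq_add_neg, exp_add]; simp
    · simp
  simp_rw [hsplit, ← mul_sum, sum_sub_distrib, ← mul_sum, sum_boole]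
  have hk := one_sub_mul_le_exp hu hu' hη hp
  have he : exp (-u) ≤ 1 := exp_le_one_iff.2 (by linarith)
  have h1 : (∑ ω ∈ Ω, (1 : ℝ)) - (1 - exp (-u)) * #{ω ∈ Ω | hit ω} ≤
      #Ω * exp (-(u * (p * (1 - η)))) := by
    simp only [sum_const, nsmul_eq_mul, mul_one]
    have := mul_le_mul_of_nonneg_left hc (sub_nonneg.2 he)
    have h2 := mul_le_mul_of_nonneg_left hk (Nat.cast_nonneg (α := ℝ) #Ω)
    nlinarith
  calc _ ≤ exp (u * (p * (1 - η))) * (#Ω * exp (-(u * (p * (1 - η))))) :=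
        mul_le_mul_of_nonneg_left h1 (exp_pos _).le
    _ = #Ω := by rw [mul_comm, mul_assoc, ← exp_add]; simp

/-- One step of the method of conditional expectations. -/
theorem exists_option_potential_le {α I : Type*} {p η : ℝ} (hη : η ≤ 1) (hp : 0 ≤ p)
    (Ω : Finset α) (hΩ : Ω.Nonempty) (K : Finset I) (e u : I → ℝ) (hit : α → I → Prop)
    (he : ∀ k ∈ K, 0 ≤ e k) (hu : ∀ k ∈ K, 0 ≤ u k) (hu' : ∀ k ∈ K, u k ≤ η)
    (hcard : ∀ k ∈ K, u k ≠ 0 → p * #Ω ≤ #{ω ∈ Ω | hit ω k}) :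
    ∃ ω ∈ Ω, ∑ k ∈ K, e k * exp (u k * (p * (1 - η) - if hit ω k then 1 else 0)) ≤
      ∑ k ∈ K, e k := by
  apply exists_le_of_sum_le hΩ
  rw [sum_comm]
  simp_rw [← mul_sum]
  rw [sum_const, nsmul_eq_mul, mul_sum]
  refine sum_le_sum fun k hk => ?_
  rw [mul_comm (#Ω : ℝ)]
  exact mul_le_mul_of_nonneg_left
    (sum_exp_le_card hη hp Ω (fun ω => hit ω k) (hu k hk) (hu' k hk) (hcard k hk)) (he k hk)

/-- Sequential choice of options with pairwise disjoint footprints, controlling a potential. -/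
theorem exists_disjoint_choice_potential_le {ι α I V : Type*} [Nonempty α] {p η : ℝ}
    (hη : η ≤ 1) (hp : 0 ≤ p) (J : Finset ι) (fp : α → Finset V) (c : ℕ)
    (hfp : ∀ ω, #(fp ω) ≤ c) (D : ι → Finset α) (K : Finset I) (u : ι → I → ℝ)
    (hit : ι → α → I → Prop) (hu : ∀ i k, 0 ≤ u i k) (hu' : ∀ i k, u i k ≤ η)
    (H : ∀ i ∈ J, ∀ X : Finset V, #X ≤ c * #J →
      ({ω ∈ D i | Disjoint (fp ω) X}).Nonempty ∧ ∀ k ∈ K, u i k ≠ 0 →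
        p * #{ω ∈ D i | Disjoint (fp ω) X} ≤ #{ω ∈ {ω ∈ D i | Disjoint (fp ω) X} | hit i ω k}) :
    ∃ s : ι → α, (∀ i ∈ J, s i ∈ D i) ∧
      (∀ i ∈ J, ∀ j ∈ J, i ≠ j → Disjoint (fp (s i)) (fp (s j))) ∧
      ∑ k ∈ K, exp (∑ i ∈ J, u i k * (p * (1 - η) - if hit i (s i) k then 1 else 0)) ≤
        #K := by
  suffices h : ∀ J' ⊆ J, ∃ s : ι → α, (∀ i ∈ J', s i ∈ D i) ∧
      (∀ i ∈ J', ∀ j ∈ J', i ≠ j → Disjoint (fp (s i)) (fp (s j))) ∧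
      ∑ k ∈ K, exp (∑ i ∈ J', u i k * (p * (1 - η) - if hit i (s i) k then 1 else 0)) ≤
        #K from h J subset_rfl
  intro J'
  induction J' using Finset.induction_on with
  | empty => intro _; exact ⟨fun _ => Classical.arbitrary α, by simp, by simp, by simp⟩
  | insert a J' ha ih =>
    intro hJ
    obtain ⟨haJ, hJ'⟩ := insert_subset_iff.1 hJ
    obtain ⟨s, hs1, hs2, hs3⟩ := ih hJ'
    obtain ⟨hne, hH⟩ := H a haJ (J'.biUnion fun i => fp (s i)) (by
      refine (card_biUnion_le_card_mul _ _ c fun i _ => hfp _).trans ?_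
      rw [mul_comm]
      exact Nat.mul_le_mul_left _ (card_le_card hJ'))
    obtain ⟨ω, hω, hle⟩ := exists_option_potential_le hη hp _ hne K
      (fun k => exp (∑ i ∈ J', u i k * (p * (1 - η) - if hit i (s i) k then 1 else 0)))
      (u a) (hit a) (fun k _ => (exp_pos _).le) (fun k _ => hu a k) (fun k _ => hu' a k) hH
    rw [mem_filter, disjoint_biUnion_right] at hω
    have hupd : ∀ i ∈ J', Function.update s a ω i = s i := fun i hi =>
      Function.update_of_ne (ne_of_mem_of_not_mem hi ha) _ _
    refine ⟨Function.update s a ω, ?_, ?_, ?_⟩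
    · intro i hi
      rcases mem_insert.1 hi with rfl | hi
      · simpa using hω.1
      · rw [hupd i hi]; exact hs1 i hi
    · intro i hi j hj hij
      rcases mem_insert.1 hi with hi' | hi' <;> rcases mem_insert.1 hj with hj' | hj'
      · exact absurd (hi'.trans hj'.symm) hij
      · rw [hupd j hj', hi', Function.update_self]; exact hω.2 j hj'
      · rw [hupd i hi', hj', Function.update_self]; exact (hω.2 i hi').symm
      · rw [hupd i hi', hupd j hj']; exact hs2 i hi' j hj' hij
    · refine le_trans (le_of_eq ?_) (hle.trans hs3)
      refine sum_congr rfl fun k _ => ?_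
      rw [sum_insert ha, add_comm, exp_add, Function.update_self]
      congr 2
      exact sum_congr rfl fun i hi => by rw [hupd i hi]

/-- A bounded potential forces many hits. -/
theorem mul_le_card_hits {ι : Type*} {η P q N : ℝ} (hη : 0 < η) (J : Finset ι)
    (hit : ι → Prop) (h : exp (∑ i ∈ J, η * (P - if hit i then 1 else 0)) ≤ N)
    (hN : N < exp (η * ((P - q) * #J))) : q * #J ≤ #{i ∈ J | hit i} := by
  have h1 := exp_lt_exp.1 (h.trans_lt hN)
  rw [← mul_sum, sum_sub_distrib, sum_const, sum_boole, nsmul_eq_mul] at h1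
  have h2 := lt_of_mul_lt_mul_left h1 hη.le
  linarith

/-- A choice of distinct vertices meeting every set of a family in at least its expected share. -/
theorem exists_injOn_hits_ge {ι V I : Type*} [Fintype V] [Fintype I] {p q η : ℝ} (hη : 0 < η)
    (hη1 : η ≤ 1) (hp : 0 ≤ p) (A : I → Finset V) (X₀ : Finset V) (J : Finset ι)
    (hs : #X₀ + #J < Fintype.card V)
    (hA : ∀ X : Finset V, #X ≤ #X₀ + #J → ∀ k, p * #(univ \ X) ≤ #(A k \ X))
    (hI : (Fintype.card I : ℝ) < exp (η * ((p * (1 - η) - q) * #J))) :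
    ∃ f : ι → V, Set.InjOn f J ∧ (∀ i ∈ J, f i ∉ X₀) ∧
      ∀ k, q * #J ≤ #{i ∈ J | f i ∈ A k} := by
  have : Nonempty V := Fintype.card_pos_iff.1 (by omega)
  have hset : ∀ X : Finset V, ({v ∈ univ \ X₀ | Disjoint ({v} : Finset V) X}) =
      univ \ (X₀ ∪ X) := by
    intro X; ext v; simp
  obtain ⟨f, hf1, hf2, hf3⟩ := exists_disjoint_choice_potential_le (V := V) hη1 hp
    J (fun v => {v}) 1 (by simp) (fun _ => univ \ X₀)
    (univ : Finset I) (fun _ _ => η) (fun _ v k => v ∈ A k) (fun _ _ => hη.le) (fun _ _ => le_rfl)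
    (by
      intro i _ X hX
      rw [one_mul] at hX
      have hc : #(X₀ ∪ X) ≤ #X₀ + #J := (card_union_le _ _).trans (by omega)
      have he : univ \ (X₀ ∪ X) = (X₀ ∪ X)ᶜ := by ext; simp
      rw [hset]
      refine ⟨?_, fun k _ _ => ?_⟩
      · rw [← card_pos, he, card_compl]; omega
      · convert hA _ hc k using 3
        ext v
        simp [and_comm])
  refine ⟨f, ?_, fun i hi => (mem_sdiff.1 (hf1 i hi)).2, fun k => ?_⟩
  · intro i hi j hj hij
    by_contra hne
    have := hf2 i hi j hj hne
    simp [hij] at this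
  -- The summands are positive, so each event alone inherits the bound by the number of events: a
  -- union bound.
  · have h1 := (single_le_sum (fun k _ => (exp_pos _).le) (mem_univ k)).trans hf3
    convert mul_le_card_hits (q := q) hη J (fun i => f i ∈ A k) h1 (by simpa using hI)

end Potential

end SpanningTrees

namespace SpanningTrees

open Finset Real

/-! ### Peeling trees, and the reduction to Hall's condition. -/

section Trees

open scoped Classical

/-- A neighbour of `a` closer to `t` lies on the unique path from `t` to `a`, just before `a`. -/
theorem exists_forall_adj_dist_eq {U : Type*} {T : SimpleGraph U} (hT : T.IsTree) (t a : U) :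
    ∃ b, ∀ d, T.Adj a d → T.dist t a = T.dist t d + 1 → d = b := by
  obtain ⟨p, hp, -⟩ := hT.connected.exists_path_of_dist t a
  refine ⟨p.penultimate, fun d had hd => ?_⟩
  obtain ⟨q, hq, hq'⟩ := hT.connected.exists_path_of_dist t d
  refine hT.isAcyclic.eq_penultimate_of_adj_end hp had ?_
  refine hT.isAcyclic.mem_support_of_ne_mem_support_of_adj_of_isPath hp hq had fun ha => ?_
  have h1 := SimpleGraph.dist_le (q.takeUntil a ha)
  have h2 := q.length_takeUntil_le_length ha
  omega

/-- A set of at least two vertices of a tree has a vertex different from `t` with at most one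
neighbour in the set. -/
theorem exists_mem_forall_adj_eq {U : Type*} {T : SimpleGraph U} (hT : T.IsTree) {A : Finset U}
    {t : U} (ht : t ∈ A) (hA : ∃ a ∈ A, a ≠ t) :
    ∃ a ∈ A, a ≠ t ∧ ∃ b ∈ A, b ≠ a ∧ ∀ d ∈ A, T.Adj a d → d = b := by
  obtain ⟨a, haA, hmax⟩ := exists_max_image A (T.dist t) ⟨t, ht⟩
  have hat : a ≠ t := by
    rintro rfl
    obtain ⟨c, hc, hca⟩ := hA
    have h1 := hmax c hc
    have h2 := hT.connected.pos_dist_of_ne hca.symm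
    simp only [SimpleGraph.dist_self] at h1
    omega
  obtain ⟨b, hb⟩ := exists_forall_adj_dist_eq hT t a
  have hb' : ∀ d ∈ A, T.Adj a d → d = b := fun d hd had => hb d had (by
    have := hT.dist_eq_dist_add_one_of_adj t had
    have := hmax d hd
    omega)
  refine ⟨a, haA, hat, ?_⟩
  by_cases h : ∃ d ∈ A, T.Adj a d
  · obtain ⟨d, hd, had⟩ := h
    obtain rfl := hb' d hd had
    exact ⟨d, hd, had.ne', hb'⟩
  -- Without neighbours in `A` the condition on `b` is vacuous, and `t` serves as a dummy.
  · push Not at h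
    exact ⟨t, ht, hat.symm, fun d hd had => absurd had (h d hd)⟩

/-- Two vertices of degree one which are adjacent make up the whole tree. -/
theorem eq_or_eq_of_adj_unique {U : Type*} {T : SimpleGraph U} (hT : T.IsTree) {a b t : U}
    (ha : ∀ d, T.Adj a d → d = b) (hb : ∀ d, T.Adj b d → d = a) : t = a ∨ t = b := by
  obtain ⟨p⟩ := hT.connected a t
  suffices h : ∀ (x y : U), T.Walk x y → (x = a ∨ x = b) → (y = a ∨ y = b) from
    h a t p (Or.inl rfl)
  intro x y q
  induction q with
  | nil => exact id
  | cons h _ ih =>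
    rintro (rfl | rfl)
    · exact ih (Or.inr (ha _ h))
    · exact ih (Or.inl (hb _ h))

/-- On the neighbours of `L` every `g` agrees with `φ`, so which vertices a member of `L` accepts is
known before `g` is. Only the free set `R` varies. Values of `φ` off `T* - L` play no role. -/
theorem exists_extension {U V : Type*} [Fintype U] [Fintype V] {T : SimpleGraph U}
    {G : SimpleGraph V} {Tstar : T.Subgraph} {t : U} {w' : V} {L : Finset U} {S : Finset V}
    (hcard : Fintype.card U = Fintype.card V) (ht : t ∈ Tstar.verts) (htL : t ∉ L)
    (hL : ∀ l ∈ L, ∀ n, T.Adj l n → n ∈ Tstar.verts ∧ n ∉ L) (φ : U → V) (hφt : φ t = w')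
    (hinj : ∀ a ∈ Tstar.verts, a ∉ L → ∀ b ∈ Tstar.verts, b ∉ L → φ a = φ b → a = b)
    (hS : ∀ a ∈ Tstar.verts, a ∉ L → φ a ∉ S)
    (hadj : ∀ a ∈ Tstar.verts, a ∉ L → ∀ b ∈ Tstar.verts, b ∉ L → T.Adj a b →
      G.Adj (φ a) (φ b))
    (hHall : ∀ R : Finset V, S ⊆ R → #R = #L → (∀ a ∈ Tstar.verts, a ∉ L → φ a ∉ R) →
      ∀ A ⊆ L, #A ≤ #{v ∈ R | ∃ l ∈ A, ∀ n, T.Adj l n → G.Adj v (φ n)}) :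
    ∃ f : (Tstar.deleteVerts (L : Set U)).coe.Copy (G.induce (S : Set V)ᶜ),
      (∃ ht : t ∈ (Tstar.deleteVerts (L : Set U)).verts, (f ⟨t, ht⟩ : V) = w') ∧
      ∀ g : (T.induce (L : Set U)ᶜ).Copy (G.induce (S : Set V)ᶜ),
        (∀ (x : U) (hx : x ∈ (Tstar.deleteVerts (L : Set U)).verts) (hx' : x ∈ (L : Set U)ᶜ),
          g ⟨x, hx'⟩ = f ⟨x, hx⟩) →
        ∃ h : T.Copy G, ∀ x : ((L : Set U)ᶜ : Set U), h x = (g x : V) := by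
  refine ⟨⟨⟨fun x => ⟨φ x, hS x x.2.1 x.2.2⟩, ?_⟩, ?_⟩, ⟨⟨ht, htL⟩, hφt⟩, ?_⟩
  · rintro ⟨a, ha⟩ ⟨b, hb⟩ hab
    exact hadj a ha.1 ha.2 b hb.1 hb.2 
      (SimpleGraph.Subgraph.coe_adj_sub _ ⟨a, ha⟩ ⟨b, hb⟩ hab)
  · rintro ⟨a, ha⟩ ⟨b, hb⟩ hab
    exact Subtype.ext (hinj a ha.1 ha.2 b hb.1 hb.2 (congrArg Subtype.val hab))
  · intro g hg
    have hgφ : ∀ x ∈ Tstar.verts, ∀ hx : x ∉ L, (g ⟨x, hx⟩ : V) = φ x := fun x hx hxL =>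
      congrArg Subtype.val (hg x ⟨hx, hxL⟩ hxL)
    have hginj : ∀ x y (hx : x ∉ L) (hy : y ∉ L), (g ⟨x, hx⟩ : V) = g ⟨y, hy⟩ → x = y := by
      intro x y hx hy hxy
      exact congrArg Subtype.val (g.injective (Subtype.ext hxy))
    have hgadj : ∀ x y (hx : x ∉ L) (hy : y ∉ L), T.Adj x y →
        G.Adj (g ⟨x, hx⟩ : V) (g ⟨y, hy⟩ : V) := fun x y hx hy hxy =>
      g.toHom.map_adj (v := ⟨x, hx⟩) (w := ⟨y, hy⟩) (SimpleGraph.induce_adj.2 hxy)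
    -- `I` is the image of `g`; its complement is the free set `R` of `hHall`.
    let I : Finset V := (Lᶜ).attach.image fun x => (g ⟨x.1, mem_compl.1 x.2⟩ : V)
    have hI : #I = Fintype.card U - #L := by
      rw [card_image_of_injective, card_attach, card_compl]
      intro x y hxy
      exact Subtype.ext (hginj _ _ _ _ hxy)
    have hmemI : ∀ x (hx : x ∉ L), (g ⟨x, hx⟩ : V) ∈ I := fun x hx =>
      mem_image.2 ⟨⟨x, by simpa using hx⟩, mem_attach _ _, rfl⟩
    have hR : #(Iᶜ) = #L := by
      rw [card_compl, hI, ← hcard]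
      have := card_le_univ L
      omega
    have hSR : S ⊆ Iᶜ := by
      intro v hv
      rw [mem_compl]
      intro hvI
      obtain ⟨x, -, rfl⟩ := mem_image.1 hvI
      exact (g _).2 hv
    have hφR : ∀ a ∈ Tstar.verts, a ∉ L → φ a ∉ Iᶜ := by
      intro a ha haL
      rw [← hgφ a ha haL, mem_compl, not_not]
      exact hmemI a haL
    have hH := hHall _ hSR hR hφR
    obtain ⟨σ, hσ, hσ'⟩ := (all_card_le_biUnion_card_iff_exists_injective
      (fun l : L => ({v ∈ Iᶜ | ∀ n, T.Adj l n → G.Adj v (φ n)} : Finset V))).1 (by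
        intro A
        have := hH (A.map (Function.Embedding.subtype _)) (by
          intro x hx
          obtain ⟨y, -, rfl⟩ := mem_map.1 hx
          exact y.2)
        rw [card_map] at this
        refine this.trans (card_le_card ?_)
        intro v hv
        rw [mem_filter] at hv
        obtain ⟨hv, l, hl, hvl⟩ := hv
        obtain ⟨y, hy, rfl⟩ := mem_map.1 hl
        exact mem_biUnion.2 ⟨y, hy, mem_filter.2 ⟨hv, hvl⟩⟩)
    have hσI : ∀ l, σ l ∉ I := fun l => mem_compl.1 (mem_filter.1 (hσ' l)).1
    have hσadj : ∀ l n, T.Adj l.1 n → G.Adj (σ l) (φ n) := fun l =>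
      (mem_filter.1 (hσ' l)).2
    refine ⟨⟨⟨fun x => if hx : x ∈ L then σ ⟨x, hx⟩ else (g ⟨x, hx⟩ : V), ?_⟩, ?_⟩, ?_⟩
    · intro a b hab
      by_cases ha : a ∈ L <;> by_cases hb : b ∈ L
      · exact absurd hb (hL a ha b hab).2
      · simp only [ha, hb, dite_true, dite_false]
        rw [hgφ b (hL a ha b hab).1]
        exact hσadj ⟨a, ha⟩ b hab
      · simp only [ha, hb, dite_true, dite_false]
        rw [hgφ a (hL b hb a hab.symm).1]
        exact (hσadj ⟨b, hb⟩ a hab.symm).symm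
      · simp only [ha, hb, dite_false]
        exact hgadj a b ha hb hab
    · intro a b hab
      change (if hx : a ∈ L then σ ⟨a, hx⟩ else (g ⟨a, hx⟩ : V)) =
        (if hx : b ∈ L then σ ⟨b, hx⟩ else (g ⟨b, hx⟩ : V)) at hab
      by_cases ha : a ∈ L <;> by_cases hb : b ∈ L <;>
        simp only [ha, hb, dite_true, dite_false] at hab
      · exact congrArg Subtype.val (hσ hab)
      · exact absurd (hab ▸ hmemI b hb) (hσI _)
      · exact absurd (hab ▸ hmemI a ha) (hσI _)
      · exact hginj a b ha hb hab
    · rintro ⟨x, hx⟩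
      exact dif_neg hx

end Trees

end SpanningTrees

namespace SpanningTrees

open Finset Real

/-! ### Common neighbours when the minimum degree is about `2m/3`. -/

section Neighbours

open scoped Classical

/-- The neighbours of `v` as a finset. -/
noncomputable def nbr {V : Type*} [Fintype V] (G : SimpleGraph V) (v : V) : Finset V :=
  {x | G.Adj v x}

@[simp] theorem mem_nbr {V : Type*} [Fintype V] {G : SimpleGraph V} {v x : V} :
    x ∈ nbr G v ↔ G.Adj v x := by simp [nbr]

theorem sub_le_card_sdiff {V : Type*} (Y X : Finset V) : (#Y : ℝ) - #X ≤ #(Y \ X) := by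
  have := le_card_sdiff X Y
  have h : #Y ≤ #(Y \ X) + #X := by omega
  have h2 : (#Y : ℝ) ≤ #(Y \ X) + #X := by exact_mod_cast h
  linarith

variable {V : Type*} [Fintype V] {G : SimpleGraph V} {m : ℕ}

theorem IsGood.sub_one_le_card_nbr [DecidableRel G.Adj] (h : IsGood m G) (v : V) :
    (2 * m / 3 - 1 : ℝ) ≤ #(nbr G v) := by
  have h1 := h.2.1.trans (G.minDegree_le_degree v)
  have h2 : G.degree v = #(nbr G v) := by
    rw [← SimpleGraph.card_neighborFinset_eq_degree]
    congr 1
    ext x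
    simp
  rw [h2] at h1
  have h3 : 2 * m ≤ 3 * #(nbr G v) + 3 := by omega
  have h4 : (2 * m : ℝ) ≤ 3 * #(nbr G v) + 3 := by exact_mod_cast h3
  linarith

theorem sub_le_card_inter_nbr (hV : Fintype.card V = m + 1)
    (hG : ∀ v, (2 * m / 3 - 1 : ℝ) ≤ #(nbr G v)) (Y : Finset V) (v : V) :
    (#Y : ℝ) - (m / 3 + 2) ≤ #(Y ∩ nbr G v) := by
  have h1 := card_union_add_card_inter Y (nbr G v)
  have h2 := card_le_univ (Y ∪ nbr G v)
  rw [hV] at h2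
  have h3 : #Y + #(nbr G v) ≤ m + 1 + #(Y ∩ nbr G v) := by omega
  have h4 : (#Y + #(nbr G v) : ℝ) ≤ m + 1 + #(Y ∩ nbr G v) := by exact_mod_cast h3
  linarith [hG v]

theorem exists_common_nbr (hV : Fintype.card V = m + 1)
    (hG : ∀ v, (2 * m / 3 - 1 : ℝ) ≤ #(nbr G v)) (x y : V) (X : Finset V)
    (hX : (#X : ℝ) < m / 3 - 3) : ∃ z, G.Adj x z ∧ G.Adj y z ∧ z ∉ X := by
  have h1 := sub_le_card_inter_nbr hV hG (nbr G x) y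
  have h2 := sub_le_card_sdiff (nbr G x ∩ nbr G y) X
  have h3 : (0 : ℝ) < #((nbr G x ∩ nbr G y) \ X) := by linarith [hG x]
  obtain ⟨z, hz⟩ := card_pos.1 (by exact_mod_cast h3)
  simp only [mem_sdiff, mem_inter, mem_nbr] at hz
  exact ⟨z, hz.1.1, hz.1.2, hz.2⟩

/-- Distinct vertices such that any two vertices of `G` have many common neighbours
among them. -/
theorem exists_injOn_common_nbr_ge {ι : Type*} (hV : Fintype.card V = m + 1)
    (hG : ∀ v, (2 * m / 3 - 1 : ℝ) ≤ #(nbr G v)) (hm : 100000 ≤ m) (J : Finset ι)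
    (hJ : (#J : ℝ) ≤ m / 200) (hexp : ((m + 1 : ℝ)) ^ 2 < exp (#J / 100000)) :
    ∃ s : ι → V, Set.InjOn s J ∧
      ∀ a b, (3 / 10 : ℝ) * #J ≤ #{i ∈ J | G.Adj a (s i) ∧ G.Adj b (s i)} := by
  have hm' : (100000 : ℝ) ≤ m := by exact_mod_cast hm
  -- Two neighbourhoods share about `m/3` vertices, of which at most `m/200` are used up; hence the
  -- share `32/100`.
  obtain ⟨s, hs, -, h⟩ := exists_injOn_hits_ge (ι := ι) (I := V × V) (p := 32 / 100)
    (q := 3 / 10) (η := 1 / 1000) (by norm_num) (by norm_num) (by norm_num)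
    (fun k => nbr G k.1 ∩ nbr G k.2) ∅ J (by
      have h1 : (#J : ℝ) < m := by linarith
      have h2 : #J < m := by exact_mod_cast h1
      rw [hV, card_empty]; omega)
    (by
      rintro X hX ⟨a, b⟩
      have hX' : (#X : ℝ) ≤ #J := by exact_mod_cast (by simpa using hX)
      have h1 := sub_le_card_inter_nbr hV hG (nbr G a) b
      have h2 := sub_le_card_sdiff (nbr G a ∩ nbr G b) X
      have h3 : (#(univ \ X) : ℝ) ≤ m + 1 := by
        have := card_le_univ (univ \ X)
        rw [hV] at this
        exact_mod_cast this
      linarith [hG a])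
    (by
      rw [Fintype.card_prod, hV]
      push_cast
      rw [← sq]
      refine hexp.trans_le (exp_le_exp.2 ?_)
      have : (0 : ℝ) ≤ #J := Nat.cast_nonneg _
      linarith)
  refine ⟨s, hs, fun a b => (h (a, b)).trans_eq ?_⟩
  simp

theorem offDiag_card_cast {α : Type*} (Y : Finset α) :
    (#Y.offDiag : ℝ) = #Y * #Y - #Y := by
  rw [offDiag_card, Nat.cast_sub (Nat.le_mul_self _)]
  push_cast
  ring

/-- Disjoint pairs `x i`, `y i` of neighbours of the vertices `s i`, such that for any `a`, `b`,
`v` there are many `i` for which `s i` is a common neighbour of `a` and `b`, while `v` is a common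
neighbour of `x i` and `y i`. -/
theorem exists_pairs {ι : Type*} (hV : Fintype.card V = m + 1)
    (hG : ∀ v, (2 * m / 3 - 1 : ℝ) ≤ #(nbr G v)) (hm : 100000 ≤ m) (I J : Finset ι)
    (hJI : J ⊆ I) (X₀ : Finset V) (hX₀ : (#X₀ + 2 * #I : ℝ) ≤ m / 30) (s : ι → V)
    (hs : ∀ a b, (3 / 10 : ℝ) * #J ≤ #{i ∈ J | G.Adj a (s i) ∧ G.Adj b (s i)})
    (hexp : ((m + 1 : ℝ)) ^ 3 < exp (#J / 100000)) :
    ∃ x y : ι → V, (∀ i ∈ I, x i ∉ X₀ ∧ y i ∉ X₀ ∧ x i ≠ y i) ∧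
      (∀ i ∈ J, G.Adj (s i) (x i) ∧ G.Adj (s i) (y i)) ∧
      (∀ i ∈ I, ∀ j ∈ I, i ≠ j → x i ≠ x j ∧ x i ≠ y j ∧ y i ≠ y j) ∧
      ∀ v a b, (3 / 100 : ℝ) * #J ≤
        #{i ∈ J | (G.Adj a (s i) ∧ G.Adj b (s i)) ∧ G.Adj v (x i) ∧ G.Adj v (y i)} := by
  have hm' : (100000 : ℝ) ≤ m := by exact_mod_cast hm
  have hne : Nonempty V := Fintype.card_pos_iff.1 (by omega)
  -- Indices outside `J` have no `s i` to respect: their pairs only need to be disjoint from the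
  -- rest.
  let Y : ι → Finset V := fun i => (if i ∈ J then nbr G (s i) else univ) \ X₀
  have hfil : ∀ (Z X : Finset V), ({ω ∈ Z.offDiag | Disjoint ({ω.1, ω.2} : Finset V) X}) =
      (Z \ X).offDiag := by
    intro Z X
    ext ω
    simp only [mem_filter, mem_offDiag, disjoint_insert_left, disjoint_singleton_left, mem_sdiff]
    tauto
  have hfil' : ∀ (Z : Finset V) (v : V),
      ({ω ∈ Z.offDiag | G.Adj v ω.1 ∧ G.Adj v ω.2}) = (Z ∩ nbr G v).offDiag := by
    intro Z v
    ext ω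
    simp only [mem_filter, mem_offDiag, mem_inter, mem_nbr]
    tauto
  have hYcard : ∀ (i : ι) (X : Finset V), (#X : ℝ) ≤ 2 * #I → (63 / 100 : ℝ) * m ≤ #(Y i \ X) := by
    intro i X hX
    have h1 := sub_le_card_sdiff (Y i) X
    have h2 := sub_le_card_sdiff (if i ∈ J then nbr G (s i) else univ) X₀
    have h3 : (2 * m / 3 - 1 : ℝ) ≤ #(if i ∈ J then nbr G (s i) else (univ : Finset V)) := by
      split_ifs
      · exact hG _
      · exact (hG (Classical.arbitrary V)).trans (by exact_mod_cast card_le_card (subset_univ _))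
    change _ ≤ (#(Y i) : ℝ) at h2
    linarith
  obtain ⟨f, hf1, hf2, hf3⟩ := exists_disjoint_choice_potential_le (V := V) (p := 1 / 5)
    (η := 1 / 100) (by norm_num) (by norm_num)
    I (fun ω : V × V => {ω.1, ω.2}) 2 (fun ω => card_le_two) (fun i => (Y i).offDiag)
    (univ : Finset (V × V × V))
    -- For the event `(v, a, b)` only indices whose `s i` is a common neighbour of `a` and `b` carry
    -- weight. A share `1/10` of these, at least `3/10` of `J`, gives `3/100`.
    (fun i k => if i ∈ J ∧ G.Adj k.2.1 (s i) ∧ G.Adj k.2.2 (s i) then 1 / 100 else 0)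
    (fun _ ω k => G.Adj k.1 ω.1 ∧ G.Adj k.1 ω.2)
    (by intro i k; split_ifs <;> norm_num) (by intro i k; split_ifs <;> norm_num)
    (by
      intro i _ X hX
      have hX' : (#X : ℝ) ≤ 2 * #I := by exact_mod_cast hX
      have hα := hYcard i X hX'
      rw [hfil]
      constructor
      · rw [← card_pos, ← Nat.cast_pos (α := ℝ), offDiag_card_cast]
        nlinarith
      · rintro ⟨v, a, b⟩ - -
        -- `v` misses about `m/3` of at least `63m/100` candidates, so it sees a share of `0.47`,
        -- and more than `1/5` of the ordered pairs.
        have hβ := sub_le_card_inter_nbr hV hG (Y i \ X) v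
        have h47 : (47 / 100 : ℝ) * #(Y i \ X) ≤ #((Y i \ X) ∩ nbr G v) := by linarith
        have key : (1 / 5 : ℝ) * #(Y i \ X).offDiag ≤ #((Y i \ X) ∩ nbr G v).offDiag := by
          rw [offDiag_card_cast, offDiag_card_cast]
          nlinarith
        rw [← hfil'] at key
        convert key)
  refine ⟨fun i => (f i).1, fun i => (f i).2, ?_, ?_, ?_, ?_⟩
  · intro i hi
    have := mem_offDiag.1 (hf1 i hi)
    exact ⟨(mem_sdiff.1 this.1).2, (mem_sdiff.1 this.2.1).2, this.2.2⟩
  · intro i hi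
    have := mem_offDiag.1 (hf1 i (hJI hi))
    simp only [Y, hi, if_true, mem_sdiff, mem_nbr] at this
    exact ⟨this.1.1, this.2.1.1⟩
  · intro i hi j hj hij
    have := hf2 i hi j hj hij
    simp only [disjoint_insert_left, disjoint_singleton_left, mem_insert, mem_singleton] at this
    tauto
  · intro v a b
    have h1 := (single_le_sum (fun k _ => (exp_pos _).le) (mem_univ (v, a, b))).trans hf3
    have hJI' : {i ∈ I | i ∈ J ∧ G.Adj a (s i) ∧ G.Adj b (s i)} =
        {i ∈ J | G.Adj a (s i) ∧ G.Adj b (s i)} := by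
      ext i
      simp only [mem_filter]
      exact ⟨fun h => h.2, fun h => ⟨hJI h.1, h⟩⟩
    simp only [ite_mul, zero_mul] at h1
    rw [← sum_filter, hJI'] at h1
    have hD := hs a b
    have h2 := mul_le_card_hits (q := 1 / 10) (by norm_num : (0 : ℝ) < 1 / 100) _
      (fun i => G.Adj v (f i).1 ∧ G.Adj v (f i).2) h1 (by
        simp only [card_univ, Fintype.card_prod, hV]
        push_cast
        calc ((m : ℝ) + 1) * ((m + 1) * (m + 1)) = (m + 1) ^ 3 := by ring
          _ < _ := hexp
          _ ≤ _ := exp_le_exp.2 (by linarith))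
    rw [filter_filter] at h2
    have h3 := (mul_le_mul_of_nonneg_left hD (by norm_num : (0 : ℝ) ≤ 1 / 10)).trans h2
    refine le_trans (le_of_eq (by ring)) (h3.trans_eq ?_)
    congr

end Neighbours

end SpanningTrees

namespace SpanningTrees

open Finset Real

/-! ### Absorption by middle vertices of paths. -/

section TypeOne

open scoped Classical

/-- Greedy extension of an injective homomorphism, each new vertex having at most two neighbours
among the earlier ones. -/
theorem exists_extend_of_le_two_adj {U V : Type*} {T : SimpleGraph U}
    {G : SimpleGraph V} {M Q : Finset U} {S : Finset V} (hQM : Q ⊆ M) (ψ : U → V)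
    (hψ : Set.InjOn ψ Q) (hψS : ∀ a ∈ Q, ψ a ∉ S)
    (hψadj : ∀ a ∈ Q, ∀ b ∈ Q, T.Adj a b → G.Adj (ψ a) (ψ b))
    (hord : ∀ A, Q ⊆ A → A ⊆ M → A ≠ Q → ∃ a ∈ A, a ∉ Q ∧ ∃ b ∈ A, ∃ c ∈ A, b ≠ a ∧ c ≠ a ∧
      ∀ d ∈ A, T.Adj a d → d = b ∨ d = c)
    (hG : ∀ x y, ∀ X : Finset V, #X ≤ #S + #M → ∃ z, G.Adj x z ∧ G.Adj y z ∧ z ∉ X) :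
    ∃ φ : U → V, (∀ a ∈ Q, φ a = ψ a) ∧ Set.InjOn φ M ∧ (∀ a ∈ M, φ a ∉ S) ∧
      ∀ a ∈ M, ∀ b ∈ M, T.Adj a b → G.Adj (φ a) (φ b) := by
  suffices h : ∀ A : Finset U, Q ⊆ A → A ⊆ M → ∃ φ : U → V, (∀ a ∈ Q, φ a = ψ a) ∧
      Set.InjOn φ A ∧ (∀ a ∈ A, φ a ∉ S) ∧
      ∀ a ∈ A, ∀ b ∈ A, T.Adj a b → G.Adj (φ a) (φ b) from h M hQM subset_rfl
  intro A
  induction A using Finset.strongInduction with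
  | H A ih =>
    intro hQA hAM
    by_cases hAQ : A = Q
    · subst hAQ
      exact ⟨ψ, fun _ _ => rfl, hψ, hψS, hψadj⟩
    obtain ⟨a, ha, haQ, b, hb, c, hc, hba, hca, hd⟩ := hord A hQA hAM hAQ
    obtain ⟨φ, h1, h2, h3, h4⟩ := ih (A.erase a) (erase_ssubset ha)
      (subset_erase.2 ⟨hQA, haQ⟩) ((erase_subset _ _).trans hAM)
    obtain ⟨z, hz1, hz2, hz3⟩ := hG (φ b) (φ c) (S ∪ (A.erase a).image φ)
      ((card_union_le _ _).trans (Nat.add_le_add_left (card_image_le.trans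
        (card_le_card ((erase_subset _ _).trans hAM))) _))
    rw [mem_union, not_or] at hz3
    have hupd : ∀ x, x ≠ a → Function.update φ a z x = φ x := fun x hx =>
      Function.update_of_ne hx _ _
    have hzφ : ∀ x ∈ A, x ≠ a → φ x ≠ z := fun x hx hxa h =>
      hz3.2 (mem_image.2 ⟨x, mem_erase.2 ⟨hxa, hx⟩, h⟩)
    have hzadj : ∀ d ∈ A, T.Adj a d → G.Adj z (φ d) := by
      intro d hdA had
      rcases hd d hdA had with rfl | rfl
      · exact hz1.symm
      · exact hz2.symm
    refine ⟨Function.update φ a z, ?_, ?_, ?_, ?_⟩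
    · intro x hx
      rw [hupd x (ne_of_mem_of_not_mem hx haQ), h1 x hx]
    · intro x hx y hy hxy
      by_cases hxa : x = a <;> by_cases hya : y = a
      · rw [hxa, hya]
      · rw [hxa, hupd y hya, Function.update_self] at hxy
        exact absurd hxy.symm (hzφ y hy hya)
      · rw [hya, hupd x hxa, Function.update_self] at hxy
        exact absurd hxy (hzφ x hx hxa)
      · rw [hupd x hxa, hupd y hya] at hxy
        exact h2 (mem_erase.2 ⟨hxa, hx⟩) (mem_erase.2 ⟨hya, hy⟩) hxy
    · intro x hx
      by_cases hxa : x = a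
      · rw [hxa, Function.update_self]; exact hz3.1
      · rw [hupd x hxa]; exact h3 x (mem_erase.2 ⟨hxa, hx⟩)
    · intro x hx y hy hxy
      by_cases hxa : x = a <;> by_cases hya : y = a
      · exact absurd (hxa.trans hya.symm) hxy.ne
      · rw [hxa, hupd y hya, Function.update_self]
        exact hzadj y hy (hxa ▸ hxy)
      · rw [hya, hupd x hxa, Function.update_self]
        exact (hzadj x hx (hya ▸ hxy.symm)).symm
      · rw [hupd x hxa, hupd y hya]
        exact h4 x (mem_erase.2 ⟨hxa, hx⟩) y (mem_erase.2 ⟨hya, hy⟩) hxy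

/-- Hall's condition for slots `i ∈ I` which accept the common neighbours of `x i` and `y i`. -/
theorem card_le_card_common_nbr {ι V : Type*} {G : SimpleGraph V} {I J : Finset ι}
    {s x y : ι → V} (hs : Set.InjOn s J)
    (hadj : ∀ i ∈ J, G.Adj (s i) (x i) ∧ G.Adj (s i) (y i)) {k : ℕ}
    (hIJ : #(I \ J) ≤ k)
    (hits : ∀ v a b, k ≤
      #{i ∈ J | (G.Adj a (s i) ∧ G.Adj b (s i)) ∧ G.Adj v (x i) ∧ G.Adj v (y i)})
    {R : Finset V} (hR : ∀ i ∈ J, s i ∈ R) (hRI : #R = #I) {A : Finset ι} (hA : A ⊆ I) :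
    #A ≤ #{v ∈ R | ∃ i ∈ A, G.Adj v (x i) ∧ G.Adj v (y i)} := by
  have himg : ∀ B ⊆ J, (∀ j ∈ B, ∃ i ∈ A, G.Adj (s j) (x i) ∧ G.Adj (s j) (y i)) →
      #B ≤ #{v ∈ R | ∃ i ∈ A, G.Adj v (x i) ∧ G.Adj v (y i)} := by
    intro B hB h
    rw [← card_image_of_injOn (hs.mono (coe_subset.2 hB))]
    refine card_le_card fun v hv => ?_
    obtain ⟨j, hj, rfl⟩ := mem_image.1 hv
    exact mem_filter.2 ⟨hR j (hB hj), h j hj⟩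
  by_cases hAJ : A ⊆ J
  · exact himg A hAJ fun j hj => ⟨j, hj, hadj j (hAJ hj)⟩
  obtain ⟨i', hi'A, hi'J⟩ := not_subset.1 hAJ
  have hAk : #A ≤ #(A ∩ J) + k := by
    have h1 := card_inter_add_card_sdiff A J
    have h2 := card_le_card (sdiff_subset_sdiff hA (subset_refl J))
    omega
  -- The indices whose reserved vertex `s j` is also accepted by the slot `i'`.
  let C : Finset ι := {j ∈ J | G.Adj (x i') (s j) ∧ G.Adj (y i') (s j)}
  by_cases hC : k ≤ #(C \ A)
  · have h1 := himg (A ∩ J ∪ C \ A)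
      (union_subset inter_subset_right (sdiff_subset.trans (filter_subset _ _))) (by
        intro j hj
        rcases mem_union.1 hj with hj | hj
        · exact ⟨j, (mem_inter.1 hj).1, hadj j (mem_inter.1 hj).2⟩
        · have := (mem_filter.1 (mem_sdiff.1 hj).1).2
          exact ⟨i', hi'A, this.1.symm, this.2.symm⟩)
    rw [card_union_of_disjoint (disjoint_sdiff.mono_left inter_subset_left)] at h1
    omega
  -- Fewer than `k` indices of `C` lie outside `A`, but every `v` is accepted by at least `k` slots
  -- of `C`, hence by one in `A`. So all of `R` is accepted.
  · rw [filter_true_of_mem, hRI]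
    · exact card_le_card hA
    intro v _
    by_contra hv
    push Not at hv
    refine hC ((hits v (x i') (y i')).trans (card_le_card fun j hj => ?_))
    rw [mem_filter] at hj
    rw [mem_sdiff]
    exact ⟨mem_filter.2 ⟨hj.1, hj.2.1⟩, fun hjA => hv j hjA hj.2.2.1 hj.2.2.2⟩

/-- `S` is fixed before `w'`; the pairs `x i`, `y i` are chosen after it, so as to avoid it. They
are embedded before the rest of `T* - L`; the outer path vertices then need degree at most `2`, as
their images must be joined to vertices already placed on both sides. -/
theorem exists_of_paths {U V ι : Type*} [Fintype U] [Fintype V] {T : SimpleGraph U}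
    {G : SimpleGraph V} {Tstar : T.Subgraph} {t : U} {m k : ℕ}
    (hV : Fintype.card V = m + 1) (hU : Fintype.card U = m + 1)
    (hG : ∀ v, (2 * m / 3 - 1 : ℝ) ≤ #(nbr G v)) (hm : 100000 ≤ m) (hT : T.IsTree)
    (ht : t ∈ Tstar.verts) (hTstar : (Tstar.verts.ncard : ℝ) ≤ m / 30)
    (p : ι → Fin 5 → U) (hp : Function.Injective (Function.uncurry p))
    (hpadj : ∀ i, ∀ j : Fin 4, Tstar.Adj (p i j.castSucc) (p i j.succ))
    (hdeg : ∀ i j a b c, T.Adj (p i j) a → T.Adj (p i j) b → T.Adj (p i j) c →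
      a = b ∨ a = c ∨ b = c)
    (I J : Finset ι) (htI : ∀ i ∈ I, ∀ j, p i j ≠ t) (hJI : J ⊆ I)
    (hIJ : #I = #J + k) (hI : (#I : ℝ) ≤ m / 200) (hkJ : (k : ℝ) ≤ 3 / 100 * #J)
    (hexp : ((m + 1 : ℝ)) ^ 3 < exp (#J / 100000)) :
    ∃ (L : Finset U) (S : Finset V), (L : Set U) ⊆ Tstar.verts \ {t} ∧ #S + k = #L ∧
      ∀ w' ∉ S, ∃ f : (Tstar.deleteVerts (L : Set U)).coe.Copy (G.induce (S : Set V)ᶜ),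
      (∃ ht : t ∈ (Tstar.deleteVerts (L : Set U)).verts, (f ⟨t, ht⟩ : V) = w') ∧
      ∀ g : (T.induce (L : Set U)ᶜ).Copy (G.induce (S : Set V)ᶜ),
        (∀ (x : U) (hx : x ∈ (Tstar.deleteVerts (L : Set U)).verts) (hx' : x ∈ (L : Set U)ᶜ),
          g ⟨x, hx'⟩ = f ⟨x, hx⟩) →
        ∃ h : T.Copy G, ∀ x : ((L : Set U)ᶜ : Set U), h x = (g x : V) := by
  have hm' : (100000 : ℝ) ≤ m := by exact_mod_cast hm
  have hJI' : (#J : ℝ) ≤ #I := by exact_mod_cast card_le_card hJI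
  have hpp : ∀ {i j i' j'}, p i j = p i' j' → i = i' ∧ j = j' := fun {i j i' j'} h =>
    Prod.mk.inj (@hp (i, j) (i', j') h)
  have hmem : ∀ i j, p i j ∈ Tstar.verts := by
    intro i j
    refine Fin.cases ?_ (fun j => ?_) j
    · exact Tstar.edge_vert (hpadj i 0)
    · exact Tstar.edge_vert (hpadj i j).symm
  have h01 : ∀ i, T.Adj (p i 0) (p i 1) := fun i => (hpadj i 0).adj_sub
  have h12 : ∀ i, T.Adj (p i 1) (p i 2) := fun i => (hpadj i 1).adj_sub
  have h23 : ∀ i, T.Adj (p i 2) (p i 3) := fun i => (hpadj i 2).adj_sub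
  have h34 : ∀ i, T.Adj (p i 3) (p i 4) := fun i => (hpadj i 3).adj_sub
  have hne : ∀ i j j', j ≠ j' → p i j ≠ p i j' := fun i j j' hj h => hj (hpp h).2
  have hn1 : ∀ i b, T.Adj (p i 1) b → b = p i 0 ∨ b = p i 2 := by
    intro i b hb
    rcases hdeg i 1 b _ _ hb (h01 i).symm (h12 i) with h | h | h
    · exact Or.inl h
    · exact Or.inr h
    · exact absurd h (hne i 0 2 (by decide))
  have hn2 : ∀ i b, T.Adj (p i 2) b → b = p i 1 ∨ b = p i 3 := by
    intro i b hb
    rcases hdeg i 2 b _ _ hb (h12 i).symm (h23 i) with h | h | h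
    · exact Or.inl h
    · exact Or.inr h
    · exact absurd h (hne i 1 3 (by decide))
  have hn3 : ∀ i b, T.Adj (p i 3) b → b = p i 2 ∨ b = p i 4 := by
    intro i b hb
    rcases hdeg i 3 b _ _ hb (h23 i).symm (h34 i) with h | h | h
    · exact Or.inl h
    · exact Or.inr h
    · exact absurd h (hne i 2 4 (by decide))
  obtain ⟨s, hs, hs'⟩ := exists_injOn_common_nbr_ge hV hG hm J (by linarith)
    ((pow_le_pow_right₀ (by linarith) (by norm_num)).trans_lt hexp)
  let L : Finset U := I.image fun i => p i 2
  let S : Finset V := J.image s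
  have hLcard : #L = #I := card_image_of_injective _ fun i j h => (hpp h).1
  have hScard : #S = #J := card_image_of_injOn hs
  have htL : t ∉ L := by
    intro h
    obtain ⟨i, hi, h⟩ := mem_image.1 h
    exact htI i hi 2 h
  have hjL : ∀ i j, j ≠ 2 → p i j ∉ L := by
    intro i j hj h
    obtain ⟨i', -, h⟩ := mem_image.1 h
    exact hj (hpp h).2.symm
  refine ⟨L, S, ?_, by rw [hLcard, hScard, hIJ], fun w' hw' => ?_⟩
  · intro u hu
    obtain ⟨i, hi, rfl⟩ := mem_image.1 (mem_coe.1 hu)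
    exact ⟨hmem i 2, htI i hi 2⟩
  obtain ⟨x, y, hxy, hsxy, hdisj, hits⟩ := exists_pairs hV hG hm I J hJI (insert w' S) (by
    have : (#(insert w' S) : ℝ) ≤ #J + 1 := by
      rw [← hScard]; exact_mod_cast card_insert_le _ _
    linarith) s hs' hexp
  let M : Finset U := Tstar.verts.toFinset \ L
  have hMmem : ∀ a, a ∈ M ↔ a ∈ Tstar.verts ∧ a ∉ L := fun a => by
    rw [mem_sdiff, Set.mem_toFinset]
  have hMcard : (#M : ℝ) ≤ m / 30 := by
    refine le_trans ?_ hTstar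
    rw [Set.ncard_eq_toFinset_card']
    exact_mod_cast card_le_card sdiff_subset
  let Q : Finset U := insert t (I.image (fun i => p i 1) ∪ I.image fun i => p i 3)
  have hQmem : ∀ a, a ∈ Q ↔ a = t ∨ ∃ i ∈ I, a = p i 1 ∨ a = p i 3 := by
    intro a
    simp only [Q, mem_insert, mem_union, mem_image]
    constructor
    · rintro (h | ⟨i, hi, rfl⟩ | ⟨i, hi, rfl⟩)
      · exact Or.inl h
      · exact Or.inr ⟨i, hi, Or.inl rfl⟩
      · exact Or.inr ⟨i, hi, Or.inr rfl⟩
    · rintro (h | ⟨i, hi, rfl | rfl⟩)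
      · exact Or.inl h
      · exact Or.inr (Or.inl ⟨i, hi, rfl⟩)
      · exact Or.inr (Or.inr ⟨i, hi, rfl⟩)
  have hQM : Q ⊆ M := by
    intro a ha
    rw [hMmem]
    rcases (hQmem a).1 ha with rfl | ⟨i, hi, rfl | rfl⟩
    · exact ⟨ht, htL⟩
    · exact ⟨hmem i 1, hjL i 1 (by decide)⟩
    · exact ⟨hmem i 3, hjL i 3 (by decide)⟩
  let ψ : U → V := fun u => if u = t then w' else
    Function.extend (Function.uncurry p) (fun ij => if ij.2 = 1 then x ij.1 else y ij.1)
      (fun _ => w') u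
  have hψt : ψ t = w' := if_pos rfl
  have hψ1 : ∀ i ∈ I, ψ (p i 1) = x i := fun i hi =>
    (if_neg (htI i hi 1)).trans ((hp.extend_apply _ _ (i, 1)).trans (if_pos rfl))
  have hψ3 : ∀ i ∈ I, ψ (p i 3) = y i := fun i hi =>
    (if_neg (htI i hi 3)).trans ((hp.extend_apply _ _ (i, 3)).trans (if_neg (show (3 : Fin 5) ≠ 1 by decide)))
  have hx0 : ∀ i ∈ I, x i ≠ w' ∧ x i ∉ S := fun i hi => by
    simpa using (hxy i hi).1
  have hy0 : ∀ i ∈ I, y i ≠ w' ∧ y i ∉ S := fun i hi => by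
    simpa using (hxy i hi).2.1
  obtain ⟨φ, hφψ, hφinj, hφS, hφadj⟩ := exists_extend_of_le_two_adj (T := T) (G := G) (S := S)
    hQM ψ (by
      intro a ha b hb hab
      rcases (hQmem a).1 ha with rfl | ⟨i, hi, rfl | rfl⟩ <;>
        rcases (hQmem b).1 hb with rfl | ⟨j, hj, rfl | rfl⟩
      · rfl
      · rw [hψt, hψ1 j hj] at hab; exact absurd hab.symm (hx0 j hj).1
      · rw [hψt, hψ3 j hj] at hab; exact absurd hab.symm (hy0 j hj).1
      · rw [hψt, hψ1 i hi] at hab; exact absurd hab (hx0 i hi).1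
      · rw [hψ1 i hi, hψ1 j hj] at hab
        by_cases hij : i = j
        · rw [hij]
        · exact absurd hab (hdisj i hi j hj hij).1
      · rw [hψ1 i hi, hψ3 j hj] at hab
        by_cases hij : i = j
        · exact absurd (hij ▸ hab) (hxy i hi).2.2
        · exact absurd hab (hdisj i hi j hj hij).2.1
      · rw [hψt, hψ3 i hi] at hab; exact absurd hab (hy0 i hi).1
      · rw [hψ3 i hi, hψ1 j hj] at hab
        by_cases hij : i = j
        · exact absurd (hij ▸ hab.symm) (hxy i hi).2.2
        · exact absurd hab.symm (hdisj j hj i hi (Ne.symm hij)).2.1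
      · rw [hψ3 i hi, hψ3 j hj] at hab
        by_cases hij : i = j
        · rw [hij]
        · exact absurd hab (hdisj i hi j hj hij).2.2)
    (by
      intro a ha
      rcases (hQmem a).1 ha with rfl | ⟨i, hi, rfl | rfl⟩
      · rwa [hψt]
      · rw [hψ1 i hi]; exact (hx0 i hi).2
      · rw [hψ3 i hi]; exact (hy0 i hi).2)
    (by
      have key : ∀ i ∈ I, ∀ b ∈ Q, ¬ T.Adj (p i 1) b ∧ ¬ T.Adj (p i 3) b := by
        intro i hi b hb
        have hb' : ∀ j, j ≠ 1 → j ≠ 3 → b ≠ p i j := by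
          intro j hj1 hj3 h
          rcases (hQmem b).1 hb with rfl | ⟨i', hi', rfl | rfl⟩
          · exact htI i hi j h.symm
          · exact hj1 (hpp h).2.symm
          · exact hj3 (hpp h).2.symm
        refine ⟨fun h => ?_, fun h => ?_⟩
        · rcases hn1 i b h with h | h
          · exact hb' 0 (by decide) (by decide) h
          · exact hb' 2 (by decide) (by decide) h
        · rcases hn3 i b h with h | h
          · exact hb' 2 (by decide) (by decide) h
          · exact hb' 4 (by decide) (by decide) h
      intro a ha b hb hab
      rcases (hQmem a).1 ha with rfl | ⟨i, hi, rfl | rfl⟩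
      · rcases (hQmem b).1 hb with rfl | ⟨i, hi, rfl | rfl⟩
        · exact absurd rfl hab.ne
        · exact absurd hab.symm (key i hi _ ha).1
        · exact absurd hab.symm (key i hi _ ha).2
      · exact absurd hab (key i hi _ hb).1
      · exact absurd hab (key i hi _ hb).2)
    (by
      intro A hQA hAM hAQ
      -- Path ends are peeled first, so embedded last: at that point at most two neighbours
      -- constrain them.
      have hend : ∀ i ∈ I, ∀ j, j ≠ 1 → j ≠ 3 → p i j ∈ A → ∀ b ∈ A, T.Adj (p i j) b →
          ∃ a ∈ A, a ∉ Q ∧ ∃ b ∈ A, ∃ c ∈ A, b ≠ a ∧ c ≠ a ∧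
            ∀ d ∈ A, T.Adj a d → d = b ∨ d = c := by
        intro i hi j hj1 hj3 hA b hb hab
        refine ⟨p i j, hA, ?_, b, hb, ?_⟩
        · intro hQ
          rcases (hQmem _).1 hQ with h | ⟨i', -, h | h⟩
          · exact htI i hi j h
          · exact hj1 (hpp h).2
          · exact hj3 (hpp h).2
        by_cases h : ∃ c ∈ A, T.Adj (p i j) c ∧ c ≠ b
        · obtain ⟨c, hc, hac, hcb⟩ := h
          refine ⟨c, hc, hab.ne', hac.ne', fun d _ had => ?_⟩
          rcases hdeg i j d b c had hab hac with h | h | h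
          · exact Or.inl h
          · exact Or.inr h
          · exact absurd h.symm hcb
        · push Not at h
          exact ⟨b, hb, hab.ne', hab.ne', fun d hd had => Or.inl (h d hd had)⟩
      by_cases h0 : ∃ i ∈ I, p i 0 ∈ A
      · obtain ⟨i, hi, hA⟩ := h0
        exact hend i hi 0 (by decide) (by decide) hA (p i 1)
          (hQA ((hQmem _).2 (Or.inr ⟨i, hi, Or.inl rfl⟩))) (h01 i)
      by_cases h4 : ∃ i ∈ I, p i 4 ∈ A
      · obtain ⟨i, hi, hA⟩ := h4
        exact hend i hi 4 (by decide) (by decide) hA (p i 3)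
          (hQA ((hQmem _).2 (Or.inr ⟨i, hi, Or.inr rfl⟩))) (h34 i).symm
      -- Once no ends are left, `p i 1` and `p i 3` are isolated in `A`, since `p i 2` is in `L`.
      -- The rest is peeled as a forest, farthest from `t` first.
      push Not at h0 h4
      have h2 : ∀ i ∈ I, p i 2 ∉ A := fun i hi hA =>
        ((hMmem _).1 (hAM hA)).2 (mem_image_of_mem _ hi)
      obtain ⟨a, ha, hat, b, hb, hba, hab⟩ := exists_mem_forall_adj_eq hT
        (A := {a ∈ A | ∀ i ∈ I, a ≠ p i 1 ∧ a ≠ p i 3}) (t := t)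
        (mem_filter.2 ⟨hQA ((hQmem t).2 (Or.inl rfl)), fun i hi =>
          ⟨(htI i hi 1).symm, (htI i hi 3).symm⟩⟩)
        (by
          obtain ⟨a, haA, haQ⟩ := not_subset.1 fun h => hAQ (h.antisymm hQA)
          refine ⟨a, mem_filter.2 ⟨haA, fun i hi => ⟨fun h => ?_, fun h => ?_⟩⟩, fun h => ?_⟩
          · exact haQ ((hQmem a).2 (Or.inr ⟨i, hi, Or.inl h⟩))
          · exact haQ ((hQmem a).2 (Or.inr ⟨i, hi, Or.inr h⟩))
          · exact haQ ((hQmem a).2 (Or.inl h)))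
      rw [mem_filter] at ha hb
      refine ⟨a, ha.1, ?_, b, hb.1, b, hb.1, hba, hba, fun d hd had => ?_⟩
      · intro hQ
        rcases (hQmem _).1 hQ with h | ⟨i, hi, h | h⟩
        · exact hat h
        · exact (ha.2 i hi).1 h
        · exact (ha.2 i hi).2 h
      · refine Or.inl (hab d (mem_filter.2 ⟨hd, fun i hi => ⟨?_, ?_⟩⟩) had)
        · rintro rfl
          rcases hn1 i a had.symm with rfl | rfl
          · exact h0 i hi ha.1
          · exact h2 i hi ha.1
        · rintro rfl
          rcases hn3 i a had.symm with rfl | rfl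
          · exact h2 i hi ha.1
          · exact h4 i hi ha.1)
    (by
      intro a b X hX
      refine exists_common_nbr hV hG a b X ?_
      have : (#X : ℝ) ≤ #S + #M := by exact_mod_cast hX
      rw [hScard] at this
      linarith)
  have hφ1 : ∀ i ∈ I, φ (p i 1) = x i := fun i hi =>
    (hφψ _ ((hQmem _).2 (Or.inr ⟨i, hi, Or.inl rfl⟩))).trans (hψ1 i hi)
  have hφ3 : ∀ i ∈ I, φ (p i 3) = y i := fun i hi =>
    (hφψ _ ((hQmem _).2 (Or.inr ⟨i, hi, Or.inr rfl⟩))).trans (hψ3 i hi)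
  refine exists_extension (hU.trans hV.symm) ht htL ?_ φ
    ((hφψ t ((hQmem t).2 (Or.inl rfl))).trans hψt)
    (fun a ha haL b hb hbL hab => hφinj ((hMmem a).2 ⟨ha, haL⟩) ((hMmem b).2 ⟨hb, hbL⟩) hab)
    (fun a ha haL => hφS a ((hMmem a).2 ⟨ha, haL⟩))
    (fun a ha haL b hb hbL => hφadj a ((hMmem a).2 ⟨ha, haL⟩) b ((hMmem b).2 ⟨hb, hbL⟩)) ?_
  · intro l hl n hn
    obtain ⟨i, -, rfl⟩ := mem_image.1 hl
    rcases hn2 i n hn with rfl | rfl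
    · exact ⟨hmem i 1, hjL i 1 (by decide)⟩
    · exact ⟨hmem i 3, hjL i 3 (by decide)⟩
  · intro R hSR hRL _ A hAL
    have hAcard : #A ≤ #{i ∈ I | p i 2 ∈ A} := by
      refine (card_le_card fun l hl => ?_).trans (card_image_le (f := fun i => p i 2))
      obtain ⟨i, hi, rfl⟩ := mem_image.1 (hAL hl)
      exact mem_image_of_mem _ (mem_filter.2 ⟨hi, hl⟩)
    refine hAcard.trans ((card_le_card_common_nbr (I := I) (k := k) hs hsxy ?_ ?_ ?_
      (hRL.trans hLcard) (filter_subset _ _)).trans (card_le_card ?_))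
    · rw [card_sdiff_of_subset hJI]; omega
    · intro v a b
      have := hkJ.trans (hits v a b)
      exact_mod_cast this
    · exact fun i hi => hSR (mem_image_of_mem _ hi)
    · intro v hv
      rw [mem_filter] at hv ⊢
      obtain ⟨hvR, i, hi, hvx, hvy⟩ := hv
      rw [mem_filter] at hi
      refine ⟨hvR, p i 2, hi.2, fun n hn => ?_⟩
      rcases hn2 i n hn with rfl | rfl
      · rwa [hφ1 i hi.1]
      · rwa [hφ3 i hi.1]

end TypeOne

end SpanningTrees

namespace SpanningTrees

open Finset Real

/-! ### Absorption by leaves, with the universal vertex as one parent. -/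

section TypeTwo

open scoped Classical

/-- A set of vertices containing a large share of every neighbourhood. -/
theorem exists_finset_inter_nbr_ge {V : Type*} [Fintype V] {G : SimpleGraph V} {m : ℕ}
    (hV : Fintype.card V = m + 1) (hG : ∀ v, (2 * m / 3 - 1 : ℝ) ≤ #(nbr G v))
    (hm : 100000 ≤ m) (w : V) (N : ℕ) (hN : (N : ℝ) ≤ m / 30)
    (hexp : (m + 1 : ℝ) < exp (N / 100000)) :
    ∃ S : Finset V, #S = N ∧ w ∉ S ∧ ∀ x, (63 / 100 : ℝ) * N ≤ #(S ∩ nbr G x) := by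
  have hm' : (100000 : ℝ) ≤ m := by exact_mod_cast hm
  obtain ⟨s, hs, hsw, h⟩ := exists_injOn_hits_ge (ι := Fin N) (I := V) (p := 65 / 100)
    (q := 63 / 100) (η := 1 / 1000) (by norm_num) (by norm_num) (by norm_num)
    (fun x => nbr G x) {w} univ (by
      have h1 : (N : ℝ) < m := by linarith
      have h2 : N < m := by exact_mod_cast h1
      rw [hV, card_singleton, card_univ, Fintype.card_fin]; omega)
    (by
      intro X hX x
      rw [card_singleton, card_univ, Fintype.card_fin] at hX
      have hX' : (#X : ℝ) ≤ 1 + N := by exact_mod_cast hX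
      have h2 := sub_le_card_sdiff (nbr G x) X
      have h3 : (#(univ \ X) : ℝ) = m + 1 - #X := by
        have h4 := card_sdiff_add_card_inter univ X
        rw [univ_inter, card_univ, hV] at h4
        have : (#(univ \ X) + #X : ℝ) = m + 1 := by exact_mod_cast h4
        linarith
      rw [h3]
      linarith [hG x])
    (by
      rw [hV, card_univ, Fintype.card_fin]
      push_cast
      refine hexp.trans_le (exp_le_exp.2 ?_)
      have : (0 : ℝ) ≤ N := Nat.cast_nonneg _
      linarith)
  rw [coe_univ, Set.injOn_univ] at hs
  refine ⟨univ.image s, ?_, ?_, fun x => ?_⟩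
  · rw [card_image_of_injective _ hs, card_univ, Fintype.card_fin]
  · intro hw
    obtain ⟨i, hi, hiw⟩ := mem_image.1 hw
    exact hsw i hi (mem_singleton.2 hiw)
  · have h1 := h x
    rw [card_univ, Fintype.card_fin] at h1
    refine h1.trans ?_
    rw [← card_image_of_injective _ hs]
    refine Nat.cast_le.2 (card_le_card fun v hv => ?_)
    obtain ⟨i, hi, rfl⟩ := mem_image.1 hv
    exact mem_inter.2 ⟨mem_image_of_mem _ (mem_univ _), (mem_filter.1 hi).2⟩

/-- Embedding a forest vertex by vertex, starting at `t`, such that the weighted numbers of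
neighbours of the vertices of `G` in the image are controlled by a potential. -/
theorem exists_embedding_potential_le {U V : Type*} [Fintype V] {T : SimpleGraph U}
    {G : SimpleGraph V} {m : ℕ} (hV : Fintype.card V = m + 1)
    (hG : ∀ v, (2 * m / 3 - 1 : ℝ) ≤ #(nbr G v)) (hm : 100000 ≤ m) (hT : T.IsTree)
    {w w' : V} (hw : w ∈ G.universalVerts) (hw' : w' ≠ w) {M : Finset U} {S : Finset V}
    (hMS : (#S + #M : ℝ) ≤ m / 30) (hwS : w ∉ S) (hw'S : w' ∉ S) {t j : U} (ht : t ∈ M)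
    (htj : t ≠ j) (c : U → ℝ) (hct : c t = 0) (hc : ∀ a, 0 ≤ c a) (hc' : ∀ a, c a ≤ 1 / 100) :
    ∃ φ : U → V, φ t = w' ∧ (∀ a ∈ M, φ a = w ↔ a = j) ∧ Set.InjOn φ M ∧ (∀ a ∈ M, φ a ∉ S) ∧
      (∀ a ∈ M, ∀ b ∈ M, T.Adj a b → G.Adj (φ a) (φ b)) ∧
      ∑ v ∈ univ.erase w, exp (∑ a ∈ M, c a * (47 / 100 * (1 - 1 / 100) -
        if G.Adj v (φ a) then 1 else 0)) ≤ m := by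
  have hm' : (100000 : ℝ) ≤ m := by exact_mod_cast hm
  suffices h : ∀ A : Finset U, t ∈ A → A ⊆ M → ∃ φ : U → V, φ t = w' ∧
      (∀ a ∈ A, φ a = w ↔ a = j) ∧
      Set.InjOn φ A ∧ (∀ a ∈ A, φ a ∉ S) ∧
      (∀ a ∈ A, ∀ b ∈ A, T.Adj a b → G.Adj (φ a) (φ b)) ∧
      ∑ v ∈ univ.erase w, exp (∑ a ∈ A, c a * (47 / 100 * (1 - 1 / 100) -
        if G.Adj v (φ a) then 1 else 0)) ≤ m from h M ht subset_rfl
  intro A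
  induction A using Finset.strongInduction with
  | H A ih =>
    intro htA hAM
    by_cases hAt : ∃ a ∈ A, a ≠ t
    swap
    · push Not at hAt
      obtain rfl : A = {t} := eq_singleton_iff_unique_mem.2 ⟨htA, hAt⟩
      refine ⟨fun _ => w', rfl, ?_, ?_, ?_, ?_, ?_⟩
      · intro a ha
        rw [mem_singleton.1 ha]
        exact ⟨fun h => absurd h hw', fun h => absurd h htj⟩
      · simp
      · simpa using hw'S
      · intro a ha b hb hab
        rw [mem_singleton.1 ha, mem_singleton.1 hb] at hab
        exact absurd rfl hab.ne
      -- The image of `t` is prescribed, so it must have weight `0`; the potential starts at `|V| -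
      -- 1 = m`.
      · simp [hct, card_erase_of_mem, hV]
    obtain ⟨a, ha, hat, b, hb, hba, hd⟩ := exists_mem_forall_adj_eq hT htA hAt
    obtain ⟨φ, h0, h1, h2, h3, h4, h5⟩ := ih (A.erase a) (erase_ssubset ha)
      (mem_erase.2 ⟨hat.symm, htA⟩) ((erase_subset _ _).trans hAM)
    let X : Finset V := insert w (S ∪ (A.erase a).image φ)
    have hX : (#X : ℝ) ≤ m / 30 + 1 := by
      have h6 : #X ≤ #S + #M + 1 := (card_insert_le _ _).trans (Nat.add_le_add_right
        ((card_union_le _ _).trans (Nat.add_le_add_left (card_image_le.trans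
          (card_le_card ((erase_subset _ _).trans hAM))) _)) 1)
      have h7 : (#X : ℝ) ≤ #S + #M + 1 := by exact_mod_cast h6
      linarith
    -- The vertex `j` has `w` as its only option, which is a hit for every other vertex of `G`. This
    -- is why the potential omits `w`.
    let Ω : Finset V := if a = j then {w} else nbr G (φ b) \ X
    have hΩ : a ≠ j → (63 / 100 : ℝ) * m ≤ #Ω := by
      intro haj
      simp only [Ω, haj, if_false]
      have h6 := sub_le_card_sdiff (nbr G (φ b)) X
      linarith [hG (φ b)]
    have hbA : b ∈ A.erase a := mem_erase.2 ⟨hba, hb⟩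
    have hΩmem : ∀ z ∈ Ω, (z = w ↔ a = j) ∧ z ∉ S ∧ z ∉ (A.erase a).image φ ∧
        G.Adj (φ b) z := by
      intro z hz
      by_cases haj : a = j
      · simp only [Ω, haj, if_true, mem_singleton] at hz
        subst hz
        refine ⟨⟨fun _ => haj, fun _ => rfl⟩, hwS, ?_, ?_⟩
        · intro h
          obtain ⟨x, hx, hxz⟩ := mem_image.1 h
          exact (mem_erase.1 hx).1 (((h1 x hx).1 hxz).trans haj.symm)
        · exact (hw fun h => hba (((h1 b hbA).1 h.symm).trans haj.symm)).symm
      · simp only [Ω, haj, if_false, X, mem_sdiff, mem_nbr, mem_insert, mem_union, not_or] at hz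
        exact ⟨⟨fun h => absurd h hz.2.1, fun h => absurd h haj⟩, hz.2.2.1, hz.2.2.2, hz.1⟩
    obtain ⟨z, hz, hle⟩ := exists_option_potential_le (p := 47 / 100) (η := 1 / 100)
      (by norm_num) (by norm_num) Ω
      (by
        by_cases haj : a = j
        · simp [Ω, haj]
        · rw [← card_pos, ← Nat.cast_pos (α := ℝ)]
          linarith [hΩ haj])
      (univ.erase w)
      (fun v => exp (∑ a ∈ A.erase a, c a * (47 / 100 * (1 - 1 / 100) -
        if G.Adj v (φ a) then 1 else 0))) (fun _ => c a) (fun z v => G.Adj v z)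
      (fun _ _ => (exp_pos _).le) (fun _ _ => hc a) (fun _ _ => hc' a)
      (by
        intro v hv _
        by_cases haj : a = j
        · have hvw : G.Adj v w := (hw (ne_of_mem_erase hv).symm).symm
          rw [filter_true_of_mem]
          · have : (0 : ℝ) ≤ #Ω := Nat.cast_nonneg _
            linarith
          · intro z hz
            rwa [((hΩmem z hz).1.2 haj)]
        · have h6 := sub_le_card_inter_nbr hV hG Ω v
          have h7 : Ω ∩ nbr G v = {z ∈ Ω | G.Adj v z} := by
            ext z; simp
          rw [h7] at h6
          linarith [hΩ haj])
    obtain ⟨hz1, hz2, hz3, hz4⟩ := hΩmem z hz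
    have hupd : ∀ x, x ≠ a → Function.update φ a z x = φ x := fun x hx =>
      Function.update_of_ne hx _ _
    have hzφ : ∀ x ∈ A, x ≠ a → φ x ≠ z := fun x hx hxa h =>
      hz3 (mem_image.2 ⟨x, mem_erase.2 ⟨hxa, hx⟩, h⟩)
    have hzadj : ∀ d ∈ A, T.Adj a d → G.Adj z (φ d) := by
      intro d hdA had
      rw [hd d hdA had]
      exact hz4.symm
    refine ⟨Function.update φ a z, ?_, ?_, ?_, ?_, ?_, ?_⟩
    · rw [hupd t hat.symm, h0]
    · intro x hx
      by_cases hxa : x = a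
      · rw [hxa, Function.update_self]; exact hz1
      · rw [hupd x hxa]; exact h1 x (mem_erase.2 ⟨hxa, hx⟩)
    · intro x hx y hy hxy
      by_cases hxa : x = a <;> by_cases hya : y = a
      · rw [hxa, hya]
      · rw [hxa, hupd y hya, Function.update_self] at hxy
        exact absurd hxy.symm (hzφ y hy hya)
      · rw [hya, hupd x hxa, Function.update_self] at hxy
        exact absurd hxy (hzφ x hx hxa)
      · rw [hupd x hxa, hupd y hya] at hxy
        exact h2 (mem_erase.2 ⟨hxa, hx⟩) (mem_erase.2 ⟨hya, hy⟩) hxy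
    · intro x hx
      by_cases hxa : x = a
      · rw [hxa, Function.update_self]; exact hz2
      · rw [hupd x hxa]; exact h3 x (mem_erase.2 ⟨hxa, hx⟩)
    · intro x hx y hy hxy
      by_cases hxa : x = a <;> by_cases hya : y = a
      · exact absurd (hxa.trans hya.symm) hxy.ne
      · rw [hxa, hupd y hya, Function.update_self]
        exact hzadj y hy (hxa ▸ hxy)
      · rw [hya, hupd x hxa, Function.update_self]
        exact (hzadj x hx (hya ▸ hxy.symm)).symm
      · rw [hupd x hxa, hupd y hya]
        exact h4 x (mem_erase.2 ⟨hxa, hx⟩) y (mem_erase.2 ⟨hya, hy⟩) hxy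
    · refine le_trans (le_of_eq ?_) (hle.trans h5)
      refine sum_congr rfl fun v _ => ?_
      rw [← add_sum_erase A _ ha, add_comm, exp_add, Function.update_self]
      congr 2
      · exact sum_congr rfl fun x hx => by rw [hupd x (ne_of_mem_erase hx)]

/-- Few vertices have few neighbours, counted with multiplicity, in the image. -/
theorem card_few_hits_le {U V : Type*} {m b : ℕ} (hm : 0 < m) {K : Finset V} {L : Finset U}
    (hit : V → U → Prop) (hb : 0 < b) (hb' : (b : ℝ) ≤ m / 10 ^ 23)
    (hL : 4 / 10 ^ 9 * (m : ℝ) ≤ #L)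
    (h : ∑ v ∈ K, exp (1 / 100 / b * ∑ l ∈ L, (47 / 100 * (1 - 1 / 100) -
        if hit v l then 1 else 0 : ℝ)) ≤ m) :
    #{v ∈ K | (#{l ∈ L | hit v l} : ℝ) < 4 / 10 * #L} ≤ b := by
  have hm' : (0 : ℝ) < m := by exact_mod_cast hm
  have hb0 : (0 : ℝ) < b := by exact_mod_cast hb
  set B : Finset V := {v ∈ K | (#{l ∈ L | hit v l} : ℝ) < 4 / 10 * #L}
  -- A vertex with few hits contributes at least `e^x`: the margin is `0.47 · 0.99 - 0.4 ≥ 0.06`,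
  -- scaled by `1/100`.
  set x : ℝ := 6 / 10 ^ 4 * (#L / b) with hx
  have hx0 : 0 ≤ x := by positivity
  have hBK : B ⊆ K := fun v hv => (mem_filter.1 hv).1
  have h1 : (#B : ℝ) * exp x ≤ m := by
    refine le_trans ?_ ((sum_le_sum_of_subset_of_nonneg hBK
      fun _ _ _ => (exp_pos _).le).trans h)
    rw [← nsmul_eq_mul, ← sum_const]
    refine sum_le_sum fun v hv => exp_le_exp.2 ?_
    have h2 := (mem_filter.1 hv).2
    rw [sum_sub_distrib, sum_const, sum_boole, nsmul_eq_mul, hx,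
      show (6 / 10 ^ 4 * (#L / b) : ℝ) = 1 / 100 / b * (6 / 100 * #L) by ring]
    refine mul_le_mul_of_nonneg_left ?_ (by positivity)
    have : (0 : ℝ) ≤ #L := Nat.cast_nonneg _
    linarith
  by_contra hlt
  push Not at hlt
  have hlt' : (b : ℝ) ≤ #B := by exact_mod_cast hlt.le
  -- Since `b` may be linear in `m`, exceptions cannot be ruled out, only bounded by `b`. The cubic
  -- Taylor term suffices because `|L| / b ≥ 4 · 10^14`, which is where the bound `m / 10^23`
  -- enters.
  have h3 := pow_div_factorial_le_exp x hx0 3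
  have h4 : (b : ℝ) * (x ^ 3 / 6) ≤ m := by
    refine le_trans (mul_le_mul hlt' ?_ (by positivity) (Nat.cast_nonneg _)) h1
    simpa [Nat.factorial] using h3
  have hr : 4 * 10 ^ 14 ≤ (#L : ℝ) / b := by
    rw [le_div_iff₀ hb0]
    refine le_trans ?_ hL
    linarith
  have hx1 : 10 ^ 11 ≤ x := by rw [hx]; linarith
  have hbx : (b : ℝ) * x = 6 / 10 ^ 4 * #L := by
    rw [hx]; field_simp
  have h5 : (b : ℝ) * (x ^ 3 / 6) = 1 / 10 ^ 4 * #L * x ^ 2 := by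
    rw [show (b : ℝ) * (x ^ 3 / 6) = b * x * x ^ 2 / 6 by ring, hbx]; ring
  have h6 : (10 ^ 11 : ℝ) ^ 2 ≤ x ^ 2 := pow_le_pow_left₀ (by norm_num) hx1 2
  have h7 : 1 / 10 ^ 4 * (#L : ℝ) * (10 ^ 11) ^ 2 ≤ 1 / 10 ^ 4 * #L * x ^ 2 :=
    mul_le_mul_of_nonneg_left h6 (by positivity)
  linarith

/-- Parents equal to `t` are excluded because `w'` is arbitrary: its neighbourhood cannot be
steered. -/
theorem exists_of_leaves {U V : Type*} [Fintype U] [Fintype V] {T : SimpleGraph U}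
    {G : SimpleGraph V} {Tstar : T.Subgraph} {t : U} {m k : ℕ} {w : V}
    (hV : Fintype.card V = m + 1) (hU : Fintype.card U = m + 1)
    (hG : ∀ v, (2 * m / 3 - 1 : ℝ) ≤ #(nbr G v)) (hw : w ∈ G.universalVerts)
    (hm : 100000 ≤ m) (hT : T.IsTree)
    (ht : t ∈ Tstar.verts) (hTstar : (Tstar.verts.ncard : ℝ) ≤ m / 30)
    (L : Finset U) (par : U → U) (hLs : (L : Set U) ⊆ Tstar.verts \ {t})
    (hpar : ∀ l ∈ L, T.Adj l (par l) ∧ (∀ d, T.Adj l d → d = par l) ∧ par l ∈ Tstar.verts ∧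
      par l ∉ L ∧ par l ≠ t)
    (hb : ∀ a, (#{l ∈ L | par l = a} : ℝ) ≤ m / 10 ^ 23) (hL : 4 / 10 ^ 9 * (m : ℝ) ≤ #L)
    (hk : (k : ℝ) ≤ 1 / 1000 * #L)
    (hexp : (m + 1 : ℝ) < exp ((#L - k) / 100000)) :
    ∃ S : Finset V, #S + k = #L ∧
      ∀ w' ∉ S, w' ≠ w →
      ∃ f : (Tstar.deleteVerts (L : Set U)).coe.Copy (G.induce (S : Set V)ᶜ),
      (∃ ht : t ∈ (Tstar.deleteVerts (L : Set U)).verts, (f ⟨t, ht⟩ : V) = w') ∧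
      ∀ g : (T.induce (L : Set U)ᶜ).Copy (G.induce (S : Set V)ᶜ),
        (∀ (x : U) (hx : x ∈ (Tstar.deleteVerts (L : Set U)).verts) (hx' : x ∈ (L : Set U)ᶜ),
          g ⟨x, hx'⟩ = f ⟨x, hx⟩) →
        ∃ h : T.Copy G, ∀ x : ((L : Set U)ᶜ : Set U), h x = (g x : V) := by
  have hm' : (100000 : ℝ) ≤ m := by exact_mod_cast hm
  have hL0 : (0 : ℝ) < #L := by linarith
  have hkL : k ≤ #L := by
    have : (k : ℝ) ≤ #L := by linarith
    exact_mod_cast this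
  have htL : t ∉ L := fun h => (hLs (mem_coe.2 h)).2 rfl
  let M : Finset U := Tstar.verts.toFinset \ L
  have hMmem : ∀ a, a ∈ M ↔ a ∈ Tstar.verts ∧ a ∉ L := fun a => by
    rw [mem_sdiff, Set.mem_toFinset]
  have hML : (#M + #L : ℝ) ≤ m / 30 := by
    refine le_trans ?_ hTstar
    rw [Set.ncard_eq_toFinset_card']
    have : L ⊆ Tstar.verts.toFinset := fun l hl => Set.mem_toFinset.2 (hLs (mem_coe.2 hl)).1
    exact_mod_cast (card_sdiff_add_card_eq_card this).le
  have hM0 : (0 : ℝ) ≤ #M := Nat.cast_nonneg _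
  have hk0 : (0 : ℝ) ≤ k := Nat.cast_nonneg _
  have hcast : ((#L - k : ℕ) : ℝ) = #L - k := Nat.cast_sub hkL
  obtain ⟨S, hS, hwS, hSN⟩ := exists_finset_inter_nbr_ge hV hG hm w (#L - k)
    (by rw [hcast]; linarith) (by rwa [hcast])
  refine ⟨S, by omega, fun w' hw'S hw' => ?_⟩
  obtain ⟨j, hj, hjmax⟩ := exists_max_image (L.image par) (fun a => #{l ∈ L | par l = a})
    ((card_pos.1 (by exact_mod_cast hL0)).image par)
  obtain ⟨l₀, hl₀, hl₀j⟩ := mem_image.1 hj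
  set b := #{l ∈ L | par l = j}
  have hbpos : 0 < b := card_pos.2 ⟨l₀, mem_filter.2 ⟨hl₀, hl₀j⟩⟩
  have hb0 : (0 : ℝ) < b := by exact_mod_cast hbpos
  have htj : t ≠ j := fun h => (hpar l₀ hl₀).2.2.2.2 (hl₀j.trans h.symm)
  have hjM : j ∈ M := by
    rw [hMmem, ← hl₀j]
    exact ⟨(hpar l₀ hl₀).2.2.1, (hpar l₀ hl₀).2.2.2.1⟩
  have hble : ∀ a, #{l ∈ L | par l = a} ≤ b := by
    intro a
    by_cases ha : a ∈ L.image par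
    · exact hjmax a ha
    · rw [card_eq_zero.2]
      · exact Nat.zero_le _
      · exact filter_eq_empty_iff.2 fun l hl h => ha (mem_image.2 ⟨l, hl, h⟩)
  -- A parent is weighted by its number of leaves; division by the maximum `b` keeps the weights at
  -- most `1/100`.
  obtain ⟨φ, hφt, hφw, hφinj, hφS, hφadj, hφpot⟩ := exists_embedding_potential_le hV hG hm hT hw
    hw' (M := M) (S := S) (by rw [hS, hcast]; linarith) hwS hw'S ((hMmem t).2 ⟨ht, htL⟩) htj
    (fun a => 1 / 100 / b * #{l ∈ L | par l = a})
    (by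
      have : #{l ∈ L | par l = t} = 0 :=
        card_eq_zero.2 (filter_eq_empty_iff.2 fun l hl => (hpar l hl).2.2.2.2)
      simp [this])
    (fun a => by positivity)
    (fun a => by
      have h1 : (#{l ∈ L | par l = a} : ℝ) ≤ b := by exact_mod_cast hble a
      calc (1 / 100 / b * #{l ∈ L | par l = a} : ℝ) ≤ 1 / 100 / b * b :=
            mul_le_mul_of_nonneg_left h1 (by positivity)
        _ = 1 / 100 := by field_simp)
  have hsum : ∀ v, ∑ a ∈ M, 1 / 100 / (b : ℝ) * #{l ∈ L | par l = a} *
      (47 / 100 * (1 - 1 / 100) - if G.Adj v (φ a) then 1 else 0) =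
      1 / 100 / b * ∑ l ∈ L, (47 / 100 * (1 - 1 / 100) -
        if G.Adj v (φ (par l)) then 1 else 0 : ℝ) := by
    intro v
    rw [← sum_fiberwise_of_maps_to (g := par) (t := M)
      fun l hl => (hMmem _).2 ⟨(hpar l hl).2.2.1, (hpar l hl).2.2.2.1⟩, mul_sum]
    refine sum_congr rfl fun a _ => ?_
    rw [mul_assoc]
    congr 1
    rw [← nsmul_eq_mul, ← sum_const]
    exact sum_congr rfl fun l hl => by rw [(mem_filter.1 hl).2]
  simp_rw [hsum] at hφpot
  have hbad := card_few_hits_le (by omega) (fun v l => G.Adj v (φ (par l))) hbpos (hb j) hL hφpot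
  refine exists_extension (hU.trans hV.symm) ht htL
    (fun l hl n hn => ?_) φ hφt
    (fun a ha haL b hb hbL hab => hφinj ((hMmem a).2 ⟨ha, haL⟩) ((hMmem b).2 ⟨hb, hbL⟩) hab)
    (fun a ha haL => hφS a ((hMmem a).2 ⟨ha, haL⟩))
    (fun a ha haL b hb hbL => hφadj a ((hMmem a).2 ⟨ha, haL⟩) b ((hMmem b).2 ⟨hb, hbL⟩)) ?_
  · rw [(hpar l hl).2.1 n hn]
    exact ⟨(hpar l hl).2.2.1, (hpar l hl).2.2.2.1⟩
  intro R hSR hRL hφR A hAL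
  have hwR : w ∉ R := by
    have := hφR j ((hMmem j).1 hjM).1 ((hMmem j).1 hjM).2
    rwa [(hφw j hjM).2 rfl] at this
  have hmemN : ∀ v ∈ R, ∀ l ∈ A, G.Adj v (φ (par l)) →
      v ∈ ({v ∈ R | ∃ l ∈ A, ∀ n, T.Adj l n → G.Adj v (φ n)} : Finset V) := by
    intro v hv l hl hvl
    refine mem_filter.2 ⟨hv, l, hl, fun n hn => ?_⟩
    rwa [(hpar l (hAL hl)).2.1 n hn]
  by_cases hAj : ∃ l ∈ A, par l = j
  · obtain ⟨l, hl, hlj⟩ := hAj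
    refine (card_le_card hAL).trans (hRL ▸ card_le_card fun v hv => hmemN v hv l hl ?_)
    rw [hlj, (hφw j hjM).2 rfl]
    exact (hw (ne_of_mem_of_not_mem hv hwR).symm).symm
  push Not at hAj
  rcases A.eq_empty_or_nonempty with rfl | ⟨l, hl⟩
  · simp
  by_cases hA : (#A : ℝ) ≤ 63 / 100 * #S
  · have h1 := hSN (φ (par l))
    rw [← hS] at h1
    have h2 : #A ≤ #(S ∩ nbr G (φ (par l))) := by exact_mod_cast hA.trans h1
    refine h2.trans (card_le_card fun v hv => ?_)
    rw [mem_inter, mem_nbr] at hv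
    exact hmemN v (hSR hv.1) l hl hv.2.symm
  -- Here `|A| > 0.6 |L|`, so `A` meets the at least `0.4 |L|` leaves open to any vertex outside
  -- `B`. The loss `|B| ≤ b` is paid for by the `b` children of `j` missing from `A`.
  · rw [hS, hcast] at hA
    push Not at hA
    set B : Finset V := {v ∈ univ.erase w | (#{l ∈ L | G.Adj v (φ (par l))} : ℝ) < 4 / 10 * #L}
    have hAb : #A + b ≤ #L := by
      have h1 : Disjoint A {l ∈ L | par l = j} := by
        rw [disjoint_left]
        exact fun l hl hlj => hAj l hl (mem_filter.1 hlj).2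
      rw [← card_union_of_disjoint h1]
      exact card_le_card (union_subset hAL (filter_subset _ _))
    have hRB : #R ≤ #(R \ B) + #B := by
      have := le_card_sdiff B R
      omega
    have hsub : R \ B ⊆ {v ∈ R | ∃ l ∈ A, ∀ n, T.Adj l n → G.Adj v (φ n)} := by
      intro v hv
      rw [mem_sdiff] at hv
      have hvB : 4 / 10 * (#L : ℝ) ≤ #{l ∈ L | G.Adj v (φ (par l))} := by
        by_contra h
        exact hv.2 (mem_filter.2 ⟨mem_erase.2 ⟨ne_of_mem_of_not_mem hv.1 hwR, mem_univ _⟩,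
          not_le.1 h⟩)
      by_contra hvN
      have h1 : Disjoint A {l ∈ L | G.Adj v (φ (par l))} := by
        rw [disjoint_left]
        exact fun l hl hlv => hvN (hmemN v hv.1 l hl (mem_filter.1 hlv).2)
      have h2 : #A + #{l ∈ L | G.Adj v (φ (par l))} ≤ #L := by
        rw [← card_union_of_disjoint h1]
        exact card_le_card (union_subset hAL (filter_subset _ _))
      have h3 : (#A + #{l ∈ L | G.Adj v (φ (par l))} : ℝ) ≤ #L := by exact_mod_cast h2
      linarith
    have := card_le_card hsub
    omega

end TypeTwo

end SpanningTrees

namespace SpanningTrees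

open Finset Real

/-! ### Numerical estimates and extraction of `L` from a nice subtree. -/

section Nice

open scoped Classical

/-- The quartic Taylor term beats the cube once `m ≥ 10^60`; the cube counts the events `(v, a, b)`.
-/
theorem pow_three_lt_exp {m : ℕ} (hm : 10 ^ 60 ≤ m) {x : ℝ} (hx : (m : ℝ) / 10 ^ 14 ≤ x) :
    (m + 1 : ℝ) ^ 3 < exp x := by
  have hm' : (10 ^ 60 : ℝ) ≤ m := by exact_mod_cast hm
  have h1 := pow_div_factorial_le_exp ((m : ℝ) / 10 ^ 14) (by positivity) 4
  refine lt_of_lt_of_le ?_ (h1.trans (exp_le_exp.2 hx))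
  have h2 : (m + 1 : ℝ) ^ 3 ≤ (2 * m) ^ 3 := pow_le_pow_left₀ (by linarith) (by linarith) 3
  refine h2.trans_lt ?_
  have h3 : (Nat.factorial 4 : ℝ) = 24 := by norm_num [Nat.factorial]
  rw [h3, show ((m : ℝ) / 10 ^ 14) ^ 4 / 24 = m ^ 3 * (m / (24 * 10 ^ 56)) by ring,
    show (2 * (m : ℝ)) ^ 3 = m ^ 3 * 8 by ring]
  refine mul_lt_mul_of_pos_left ?_ (by positivity)
  rw [lt_div_iff₀ (by positivity)]
  linarith

/-- With `γ³ ≤ 30⁻³` and `432000 = 16 · 30³`, the gain is negligible against the number of available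
paths or leaves. -/
theorem ceil_pow_four_mul_le {m : ℕ} {γ : ℝ} (hγ : 2 / 10 ^ 7 ≤ γ) (hγ' : γ < 1 / 30) :
    (⌈(γ / 2) ^ 4 * m⌉₊ : ℝ) ≤ γ * m / 432000 + 1 := by
  have h0 : 0 < γ := lt_of_lt_of_le (by norm_num) hγ
  refine (Nat.ceil_lt_add_one (by positivity)).le.trans ?_
  have h1 : γ ^ 3 ≤ (1 / 30) ^ 3 := pow_le_pow_left₀ h0.le hγ'.le 3
  have h2 : (γ / 2) ^ 4 * m = γ ^ 3 * (γ * m / 16) := by ring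
  have h3 := mul_le_mul_of_nonneg_right h1 (show 0 ≤ γ * m / 16 by positivity)
  rw [h2]
  linarith

theorem ncard_le_of_card_add {U V : Type*} {L : Finset U} {S : Finset V} {x : ℝ} (hx : 0 ≤ x)
    (h : #S + ⌈x⌉₊ = #L) :
    ((S : Set V).ncard : ℤ) ≤ (L : Set U).ncard - ⌈x⌉ := by
  rw [Set.ncard_coe_finset, Set.ncard_coe_finset, ← Int.natCast_ceil_eq_ceil hx]
  omega

variable {U V : Type*} [Fintype U] [Fintype V] {T : SimpleGraph U} [DecidableRel T.Adj]
  {G : SimpleGraph V} {Tstar : T.Subgraph} {t : U} {w : V} {m : ℕ} {γ : ℝ}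

theorem IsTypeOne.exists_absorbing (hm : 10 ^ 60 ≤ m) (hγ : 2 / 10 ^ 7 ≤ γ) (hγ' : γ < 1 / 30)
    (hV : Fintype.card V = m + 1) (hU : Fintype.card U = m + 1)
    (hG : ∀ v, (2 * m / 3 - 1 : ℝ) ≤ #(nbr G v)) (hT : T.IsTree)
    (ht : t ∈ Tstar.verts) (hTstar : (Tstar.verts.ncard : ℝ) ≤ γ * m)
    (h : IsTypeOne m γ T Tstar) :
    ∃ (L : Set U) (S : Set V), L ⊆ Tstar.verts \ {t} ∧
      (S.ncard : ℤ) ≤ L.ncard - ⌈(γ / 2) ^ 4 * m⌉ ∧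
      ∀ w' : V, w' ∉ S → ∃ f : (Tstar.deleteVerts L).coe.Copy (G.induce Sᶜ),
        (∃ ht : t ∈ (Tstar.deleteVerts L).verts, (f ⟨t, ht⟩ : V) = w') ∧
        ∀ g : (T.induce Lᶜ).Copy (G.induce Sᶜ),
          (∀ (x : U) (hx : x ∈ (Tstar.deleteVerts L).verts) (hx' : x ∈ Lᶜ),
            g ⟨x, hx'⟩ = f ⟨x, hx⟩) →
          ∃ h : T.Copy G, ∀ x : (Lᶜ : Set U), h x = (g x : V) := by
  have hm' : (10 ^ 60 : ℝ) ≤ m := by exact_mod_cast hm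
  have hγm : 2 / 10 ^ 7 * (m : ℝ) ≤ γ * m := mul_le_mul_of_nonneg_right hγ (by linarith)
  have hγm' : γ * m ≤ 1 / 30 * m := mul_le_mul_of_nonneg_right hγ'.le (by linarith)
  obtain ⟨p, hp, hpadj, hdeg⟩ := h
  have hk := ceil_pow_four_mul_le (m := m) hγ hγ'
  set k := ⌈(γ / 2) ^ 4 * m⌉₊ with hk_def
  let I : Finset (Fin ⌈γ * m / 20⌉₊) := {i | ∀ j, p i j ≠ t}
  -- The paths are disjoint, so discarding those through `t` costs at most one.
  have hIc : #(Iᶜ) ≤ 1 := by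
    refine card_le_one.2 fun i hi i' hi' => ?_
    simp only [I, mem_compl, mem_filter, mem_univ, true_and, not_forall, not_not] at hi hi'
    obtain ⟨j, hj⟩ := hi
    obtain ⟨j', hj'⟩ := hi'
    exact (Prod.mk.inj (@hp (i, j) (i', j') (hj.trans hj'.symm))).1
  have hIcard : ⌈γ * m / 20⌉₊ ≤ #I + 1 := by
    have := card_add_card_compl I
    rw [Fintype.card_fin] at this
    omega
  have hIle : #I ≤ ⌈γ * m / 20⌉₊ := by simpa using card_le_univ I
  have h1 : γ * m / 20 ≤ #I + 1 := (Nat.le_ceil _).trans (by exact_mod_cast hIcard)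
  have h2 : (#I : ℝ) ≤ γ * m / 20 + 1 :=
    (Nat.cast_le.2 hIle).trans (Nat.ceil_lt_add_one (by linarith)).le
  have hkI : k ≤ #I := by
    have : (k : ℝ) ≤ #I := by linarith
    exact_mod_cast this
  obtain ⟨J, hJI, hJ⟩ := exists_subset_card_eq (Nat.sub_le #I k)
  have hJ' : (#J : ℝ) = #I - k := by rw [hJ, Nat.cast_sub hkI]
  obtain ⟨L, S, hL, hS, hmain⟩ := exists_of_paths (k := k) hV hU hG
    ((by norm_num : 100000 ≤ 10 ^ 60).trans hm) hT ht (hTstar.trans (by linarith)) p hp hpadj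
    (by
      intro i j a b c ha hb hc
      by_contra hne
      push Not at hne
      have h3 : 2 < #(T.neighborFinset (p i j)) := two_lt_card.2
        ⟨a, by simpa using ha, b, by simpa using hb, c, by simpa using hc, hne⟩
      rw [SimpleGraph.card_neighborFinset_eq_degree] at h3
      have := hdeg i j
      omega)
    I J (fun i hi => (mem_filter.1 hi).2) hJI (by omega) (by linarith) (by linarith)
    (pow_three_lt_exp hm (by linarith))
  exact ⟨L, S, hL, ncard_le_of_card_add
    (mul_nonneg (pow_nonneg (by linarith) 4) (by linarith)) hS, hmain⟩

theorem IsTypeTwo.exists_absorbing (hm : 10 ^ 60 ≤ m) (hγ : 2 / 10 ^ 7 ≤ γ) (hγ' : γ < 1 / 30)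
    (hV : Fintype.card V = m + 1) (hU : Fintype.card U = m + 1)
    (hG : ∀ v, (2 * m / 3 - 1 : ℝ) ≤ #(nbr G v)) (hw : w ∈ G.universalVerts) (hT : T.IsTree)
    (hleaf : ∀ v : U, ({u | T.Adj v u ∧ IsLeaf T u}.ncard : ℝ) ≤ m / 10 ^ 23)
    (hTs : Tstar.coe.IsTree)
    (ht : t ∈ Tstar.verts) (hTstar : (Tstar.verts.ncard : ℝ) ≤ γ * m)
    (h : IsTypeTwo m γ T Tstar) :
    ∃ (L : Set U) (S : Set V), L ⊆ Tstar.verts \ {t} ∧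
      (S.ncard : ℤ) ≤ L.ncard - ⌈(γ / 2) ^ 4 * m⌉ ∧
      ∀ w' : V, w' ∉ S → w' ≠ w → ∃ f : (Tstar.deleteVerts L).coe.Copy (G.induce Sᶜ),
        (∃ ht : t ∈ (Tstar.deleteVerts L).verts, (f ⟨t, ht⟩ : V) = w') ∧
        ∀ g : (T.induce Lᶜ).Copy (G.induce Sᶜ),
          (∀ (x : U) (hx : x ∈ (Tstar.deleteVerts L).verts) (hx' : x ∈ Lᶜ),
            g ⟨x, hx'⟩ = f ⟨x, hx⟩) →
          ∃ h : T.Copy G, ∀ x : (Lᶜ : Set U), h x = (g x : V) := by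
  have hm' : (10 ^ 60 : ℝ) ≤ m := by exact_mod_cast hm
  have hγm : 2 / 10 ^ 7 * (m : ℝ) ≤ γ * m := mul_le_mul_of_nonneg_right hγ (by linarith)
  have hγm' : γ * m ≤ 1 / 30 * m := mul_le_mul_of_nonneg_right hγ'.le (by linarith)
  have hk := ceil_pow_four_mul_le (m := m) hγ hγ'
  set k := ⌈(γ / 2) ^ 4 * m⌉₊ with hk_def
  have hpar : ∀ l, ∃ q, IsLeaf T l → T.Adj l q ∧ ∀ d, T.Adj l d → d = q := by
    intro l
    by_cases hl : IsLeaf T l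
    · obtain ⟨q, hq⟩ := card_eq_one.1 ((SimpleGraph.card_neighborFinset_eq_degree T l).trans hl)
      have hq' : ∀ d, T.Adj l d ↔ d = q := fun d => by
        rw [← SimpleGraph.mem_neighborFinset, hq, mem_singleton]
      exact ⟨q, fun _ => ⟨(hq' q).2 rfl, fun d => (hq' d).1⟩⟩
    · exact ⟨l, fun h => absurd h hl⟩
  choose par hpar using hpar
  let L : Finset U := {l | l ∈ Tstar.verts ∧ IsLeaf T l ∧ l ≠ t ∧ par l ≠ t}
  have hLmem : ∀ l, l ∈ L ↔ l ∈ Tstar.verts ∧ IsLeaf T l ∧ l ≠ t ∧ par l ≠ t := fun l => by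
    simp [L]
  have hadj : ∀ a (l : U), l ∈ L → par l = a → T.Adj a l ∧ IsLeaf T l := by
    rintro a l hl rfl
    have := ((hLmem l).1 hl).2.1
    exact ⟨((hpar l this).1).symm, this⟩
  -- The discarded leaves are `t` itself, if it is one, and those adjacent to `t`.
  have hLcard : γ * m / 40 - 1 - m / 10 ^ 23 ≤ #L := by
    have h1 : {v ∈ Tstar.verts | IsLeaf T v} ⊆
        (L : Set U) ∪ ({t} ∪ {u | T.Adj t u ∧ IsLeaf T u}) := by
      rintro l ⟨hl, hl'⟩
      by_cases hlt : l = t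
      · exact Or.inr (Or.inl hlt)
      by_cases hpt : par l = t
      · exact Or.inr (Or.inr ⟨hpt ▸ (hpar l hl').1.symm, hl'⟩)
      · exact Or.inl ((hLmem l).2 ⟨hl, hl', hlt, hpt⟩)
    have h2 := (Set.ncard_le_ncard h1 (Set.toFinite _)).trans ((Set.ncard_union_le _ _).trans
      (Nat.add_le_add_left (Set.ncard_union_le _ _) _))
    rw [Set.ncard_coe_finset, Set.ncard_singleton] at h2
    have h3 : (⌈γ * m / 40⌉₊ : ℝ) ≤ #L + (1 + {u | T.Adj t u ∧ IsLeaf T u}.ncard) := by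
      exact_mod_cast h.trans h2
    linarith [Nat.le_ceil (γ * m / 40), hleaf t]
  have hLs : (L : Set U) ⊆ Tstar.verts \ {t} := fun l hl =>
    ⟨((hLmem l).1 (mem_coe.1 hl)).1, ((hLmem l).1 (mem_coe.1 hl)).2.2.1⟩
  obtain ⟨S, hS, hmain⟩ := exists_of_leaves (k := k) hV hU hG hw
    ((by norm_num : 100000 ≤ 10 ^ 60).trans hm) hT ht (hTstar.trans (by linarith)) L par hLs
    (by
      intro l hl
      obtain ⟨hls, hleafl, hlt, hpt⟩ := (hLmem l).1 hl
      obtain ⟨hal, huniq⟩ := hpar l hleafl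
      refine ⟨hal, huniq, ?_, ?_, hpt⟩
      · obtain ⟨q⟩ := hTs.connected ⟨l, hls⟩ ⟨t, ht⟩
        cases q with
        | nil => exact absurd rfl hlt
        | @cons _ d _ hq _ =>
          rw [← huniq d (SimpleGraph.Subgraph.coe_adj_sub _ _ _ hq)]
          exact d.2
      -- Two adjacent leaves would be the whole tree, so one of them would be `t`.
      · intro hpL
        obtain ⟨-, hleafp, -, -⟩ := (hLmem _).1 hpL
        obtain ⟨-, hp2⟩ := hpar (par l) hleafp
        rcases eq_or_eq_of_adj_unique hT (t := t) huniq
          (fun d hd => (hp2 d hd).trans (hp2 l hal.symm).symm) with h | h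
        · exact hlt h.symm
        · exact hpt h.symm)
    (by
      intro a
      refine le_trans ?_ (hleaf a)
      rw [← Set.ncard_coe_finset]
      refine Nat.cast_le.2 (Set.ncard_le_ncard ?_ (Set.toFinite _))
      intro l hl
      exact hadj a l (mem_filter.1 hl).1 (mem_filter.1 hl).2)
    (by linarith) (by linarith)
    (by
      refine lt_of_le_of_lt ?_ (pow_three_lt_exp hm (by linarith))
      exact le_self_pow₀ (by linarith) (by norm_num))
  exact ⟨L, S, hLs, ncard_le_of_card_add
    (mul_nonneg (pow_nonneg (by linarith) 4) (by linarith)) hS, hmain⟩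

end Nice

end SpanningTrees

theorem lemma2p4 :
    ∃ m₀ : ℕ, ∀ m : ℕ, m₀ ≤ m → ∀ γ : ℝ, 2 / 10 ^ 7 ≤ γ → γ < 1 / 30 →
    ∀ (V : Type*) [Fintype V] (G : SimpleGraph V) [DecidableRel G.Adj] (w : V)
      (U : Type*) [Fintype U] (T : SimpleGraph U) [DecidableRel T.Adj]
      (Tstar : T.Subgraph) (t : U),
    SpanningTrees.IsGood m G → w ∈ G.universalVerts →
    T.IsTree → T.edgeSet.ncard = m →
    (∀ v : U, ({u | T.Adj v u ∧ SpanningTrees.IsLeaf T u}.ncard : ℝ) ≤ m / 10 ^ 23) →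
    SpanningTrees.IsNiceSubtree m γ T Tstar t →
    ∃ (L : Set U) (S : Set V),
      L ⊆ Tstar.verts \ {t} ∧
      (S.ncard : ℤ) ≤ L.ncard - ⌈(γ / 2) ^ 4 * m⌉ ∧
      ∀ w' : V, w' ∉ S → w' ≠ w →
        -- `f` embeds `T* - L` into `G - S` and maps the root `t` to `w'`
        ∃ f : (Tstar.deleteVerts L).coe.Copy (G.induce Sᶜ),
          (∃ ht : t ∈ (Tstar.deleteVerts L).verts, (f ⟨t, ht⟩ : V) = w') ∧
          -- every embedding `g` of `T - L` into `G - S` that extends `f`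
          ∀ g : (T.induce Lᶜ).Copy (G.induce Sᶜ),
            (∀ (x : U) (hx : x ∈ (Tstar.deleteVerts L).verts) (hx' : x ∈ Lᶜ),
              g ⟨x, hx'⟩ = f ⟨x, hx⟩) →
            -- extends to an embedding `h` of `T` into `G`
            ∃ h : T.Copy G, ∀ x : (Lᶜ : Set U), h x = (g x : V) := by
  refine ⟨10 ^ 60, fun m hm γ hγ hγ' V _ G _ w U _ T _ Tstar t hgood hw hT hedge hleaf hnice => ?_⟩
  have hG := hgood.sub_one_le_card_nbr
  have hU : Fintype.card U = m + 1 := by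
    classical
    rw [← hT.card_edgeFinset, ← hedge, Set.ncard_eq_toFinset_card', SimpleGraph.edgeFinset]
  rcases hnice.type_one_or_two with h | h
  · obtain ⟨L, S, hL, hS, hmain⟩ := h.exists_absorbing hm hγ hγ' hgood.1 hU hG hT hnice.root_mem
      hnice.card_le
    exact ⟨L, S, hL, hS, fun w' hw' _ => hmain w' hw'⟩
  · exact h.exists_absorbing hm hγ hγ' hgood.1 hU hG hw hT hleaf hnice.isTree hnice.root_mem
      hnice.card_le
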